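/- **Setting.** Let $|\cdot|$ denote the Euclidean norm in $\mathbb R^2$, or the arclength of a subset of a curve, and let $dx$ be the arclength measure. Let $\Gamma\subset\mathbb R^2$ be a connected curve of one of the following two types (for instance, a connected compact piece of the boundary of a Lipschitz domain). * *Open:* there are $a<b$ and a continuous, piecewise $C^2$ bijection $\gamma:[a,b]\to\Gamma$. * *Closed:* there are $a<b$ and a continuous, piecewise $C^2$ map $\gamma:[a,b]\to\Gamma$ with $\gamma(a)=\gamma(b)$ that is bijective on $[a,b)$; it is extended $(b-a)$-periodically to $\mathbb R$. In both cases the left derivative $\gamma'_\ell$ does not vanish on $(a,b]$, the right derivative $\gamma'_r$ does not vanish on $[a,b)$, and $\gamma'_\ell(t)+c\,\gamma'_r(t)\ne0$ for all $c>0$ and all $t\in(a,b)$ (open case), respectively all $t\in[a,b]$ (closed case). Piecewise $C^2$ means: there are finitely many breakpoints $a=t_0<\dots<t_k=b$ such that $\gamma$ is $C^2$ on each $[t_{i-1},t_i]$. For measurable $\omega\subseteq\Gamma$ put $$|u|_{H^{1/2}(\omega)}^2=\int_\omega\int_\omega\frac{|u(x)-u(y)|^2}{|x-y|^2}\,dy\,dx,\qquad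 \|u\|_{H^{1/2}(\omega)}^2=\|u\|_{L^2(\omega)}^2+|u|_{H^{1/2}(\omega)}^2,$$ and let $H^{1/2}(\omega)$ be the set of all real $u\in L^2(\omega)$ for which this norm is finite. A mesh $\mathcal T_h=\{T_1,\dots,T_n\}$ of $\Gamma$ is given by $a=\check z_0<\dots<\check z_n=b$ and $T_j=\gamma([\check z_{j-1},\check z_j])$. Its set of nodes is $\mathcal N_h=\{\gamma(\check z_j):0\le j\le n\}$. Write $h_T=|T|$ and $\kappa(\mathcal T_h)=\max\{h_T/h_{T'}:T,T'\in\mathcal T_h,\ T\cap T'\neq\emptyset\}$. If $\Gamma$ is closed, suppose that $h_T\le|\Gamma|/4$ for all $T\in\mathcal T_h$. The patch of a node $z$ is $\omega_h(z)=\bigcup\{T\in\mathcal T_h: z\in T\}$. The patches of an element $T$ are $\omega_h^0(T)=T$ and $\omega_h^{m+1}(T)=\bigcup\{T'\in\mathcal T_h:T'\cap\omega_h^m(T)\ne\emptyset\}$. Let $\mathcal X_h\subseteq L^2(\Gamma)$ be a linear subspace, $m\in\mathbb N_0$ and $q\in(0,1]$. The assumptions are: * **(A1)** for each $T\in\mathcal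 T_h$ there is a fixed $\psi_T\in\mathcal X_h$ with connected support such that $T\subseteq\operatorname{supp}(\psi_T)\subseteq\omega_h^m(T)$; * **(A2)** $\|1-\psi_T\|_{L^2(\operatorname{supp}(\psi_T))}^2\le(1-q)\,|\operatorname{supp}(\psi_T)|$ for all $T\in\mathcal T_h$. **Proposition 3.6.** Assume (A1)–(A2), and let $u\in H^{1/2}(\Gamma)$ satisfy $\int_\Gamma u\,\psi_T\,dx=0$ for all $T\in\mathcal T_h$. Then there is a constant $C_3>0$, which depends only on $\Gamma$, $m$, $\kappa(\mathcal T_h)$ and $q$, such that $$\|u\|_{H^{1/2}(\Gamma)}^2\le C_3\sum_{z\in\mathcal N_h}|u|_{H^{1/2}(\omega_h(z))}^2 .$$ -/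

import Mathlib

open Set MeasureTheory
open scoped ENNReal MeasureTheory

noncomputable section

namespace FaermannBEM

/-- The Euclidean plane `ℝ²`. The arclength measure on curves in it is the one-dimensional
Hausdorff measure `μH[1]`, which in Mathlib's normalization is the length on rectifiable curves. -/
abbrev Plane : Type := EuclideanSpace ℝ (Fin 2)

/-! ### Sobolev-Slobodeckij norm -/

/-- `‖u‖²_{L²(ω)} = ∫_ω |u(x)|² dx`, with values in `[0,∞]`. -/
def l2NormSq (ω : Set Plane) (u : Plane → ℝ) : ℝ≥0∞ :=
  ∫⁻ x in ω, ENNReal.ofReal (u x ^ 2) ∂μH[1]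

/-- `|u|²_{H^{1/2}(ω)} = ∫_ω ∫_ω |u(x) - u(y)|² / |x - y|² dy dx`, with values in `[0,∞]`.
(The diagonal, where the quotient is `0 / 0`, plays no role, as points have length zero.) -/
def hHalfSemiSq (ω : Set Plane) (u : Plane → ℝ) : ℝ≥0∞ :=
  ∫⁻ x in ω, ∫⁻ y in ω, ENNReal.ofReal ((u x - u y) ^ 2 / ‖x - y‖ ^ 2) ∂μH[1] ∂μH[1]

/-- `‖u‖²_{H^{1/2}(ω)} = ‖u‖²_{L²(ω)} + |u|²_{H^{1/2}(ω)}`. -/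
def hHalfNormSq (ω : Set Plane) (u : Plane → ℝ) : ℝ≥0∞ :=
  l2NormSq ω u + hHalfSemiSq ω u

/-- `u ∈ L²(ω)`. Functions on `ω` are represented by functions on the plane, whose values
off `ω` never matter. -/
def MemL2 (ω : Set Plane) (u : Plane → ℝ) : Prop :=
  MemLp u 2 (μH[1].restrict ω)

/-- `u ∈ H^{1/2}(ω)`. -/
def MemHHalf (ω : Set Plane) (u : Plane → ℝ) : Prop :=
  MemL2 ω u ∧ hHalfNormSq ω u < ∞

/-! ### Parametrized boundary pieces -/

/-- The left derivative of `γ` at `t`. -/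
def leftDeriv (γ : ℝ → Plane) (t : ℝ) : Plane := derivWithin γ (Iic t) t

/-- The right derivative of `γ` at `t`. -/
def rightDeriv (γ : ℝ → Plane) (t : ℝ) : Plane := derivWithin γ (Ici t) t

/-- `γ` is piecewise two times continuously differentiable on `[a,b]`: there are finitely many
breakpoints `a = t₀ < … < t_k = b` such that `γ` is `C²` on each `[t_{i-1}, t_i]`,
endpoints included. -/
def PiecewiseC2 (γ : ℝ → Plane) (a b : ℝ) : Prop :=
  ∃ (k : ℕ) (t : Fin (k + 1) → ℝ), StrictMono t ∧ t 0 = a ∧ t (Fin.last k) = b ∧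
    ∀ i : Fin k, ContDiffOn ℝ 2 γ (Icc (t i.castSucc) (t i.succ))

/-- `γ` restricted to `[a,b]` is an admissible parametrization of the open curve `Γ`. -/
structure IsOpenParam (γ : ℝ → Plane) (a b : ℝ) (Γ : Set Plane) : Prop where
  lt : a < b
  continuousOn : ContinuousOn γ (Icc a b)
  bijOn : BijOn γ (Icc a b) Γ
  piecewiseC2 : PiecewiseC2 γ a b
  leftDeriv_ne_zero : ∀ t ∈ Ioc a b, leftDeriv γ t ≠ 0
  rightDeriv_ne_zero : ∀ t ∈ Ico a b, rightDeriv γ t ≠ 0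
  no_cusp : ∀ t ∈ Ioo a b, ∀ c : ℝ, 0 < c → leftDeriv γ t + c • rightDeriv γ t ≠ 0

/-- `γ` is the periodic extension of an admissible parametrization on `[a,b]` of the closed
curve `Γ`. -/
structure IsClosedParam (γ : ℝ → Plane) (a b : ℝ) (Γ : Set Plane) : Prop where
  lt : a < b
  continuous : Continuous γ
  periodic : Function.Periodic γ (b - a)
  bijOn : BijOn γ (Ico a b) Γ
  piecewiseC2 : PiecewiseC2 γ a b
  leftDeriv_ne_zero : ∀ t ∈ Ioc a b, leftDeriv γ t ≠ 0
  rightDeriv_ne_zero : ∀ t ∈ Ico a b, rightDeriv γ t ≠ 0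
  no_cusp : ∀ t ∈ Icc a b, ∀ c : ℝ, 0 < c → leftDeriv γ t + c • rightDeriv γ t ≠ 0

/-! ### Meshes -/

/-- A mesh of the curve `γ([a,b])`, given by parameters `a = ž₀ < ž₁ < … < žₙ = b`. -/
structure Mesh (γ : ℝ → Plane) (a b : ℝ) where
  n : ℕ
  knot : Fin (n + 1) → ℝ
  strictMono : StrictMono knot
  knot_zero : knot 0 = a
  knot_last : knot (Fin.last n) = b

namespace Mesh

variable {γ : ℝ → Plane} {a b : ℝ}

/-- The element `γ([ž_{j-1}, ž_j])`; here `j` runs through `0, …, n - 1`. -/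
def element (𝒯 : Mesh γ a b) (j : Fin 𝒯.n) : Set Plane :=
  γ '' Icc (𝒯.knot j.castSucc) (𝒯.knot j.succ)

/-- The arclength `h_T` of an element. -/
def len (𝒯 : Mesh γ a b) (j : Fin 𝒯.n) : ℝ := (μH[1] (𝒯.element j)).toReal

open Classical in
/-- The set of nodes, as points of the curve: if `γ` is closed, then `γ(ž₀) = γ(žₙ)` is one
node. -/
def nodes (𝒯 : Mesh γ a b) : Finset Plane :=
  Finset.univ.image (fun i => γ (𝒯.knot i))

/-- The shape regularity constant: the maximum of `h_T / h_{T'}` over all pairs of elements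
with `T ∩ T' ≠ ∅` (a finite set of ratios). -/
def shapeConst (𝒯 : Mesh γ a b) : ℝ :=
  sSup {r : ℝ | ∃ i j : Fin 𝒯.n,
    (𝒯.element i ∩ 𝒯.element j).Nonempty ∧ r = 𝒯.len i / 𝒯.len j}

/-- The node patch `ω_h(z)`, the union of the elements that contain `z`. -/
def nodePatch (𝒯 : Mesh γ a b) (z : Plane) : Set Plane :=
  {x | ∃ j : Fin 𝒯.n, z ∈ 𝒯.element j ∧ x ∈ 𝒯.element j}

/-- The patch `ω_h^m(T)` of order `m` of an element `T`: `ω_h^0(T) = T`, and `ω_h^{m+1}(T)` is the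
union of the elements that meet `ω_h^m(T)`. -/
def patch (𝒯 : Mesh γ a b) (j : Fin 𝒯.n) : ℕ → Set Plane
  | 0 => 𝒯.element j
  | m + 1 => {x | ∃ i : Fin 𝒯.n,
      (𝒯.element i ∩ 𝒯.patch j m).Nonempty ∧ x ∈ 𝒯.element i}

end Mesh

/-- The support in `Γ` of a function on `Γ`. -/
def suppOn (Γ : Set Plane) (ψ : Plane → ℝ) : Set Plane :=
  closure {x ∈ Γ | ψ x ≠ 0}

/-- Assumption (A1): the functions `ψ_T` belong to the discrete space `X`, and have connected
supports with `T ⊆ supp ψ_T ⊆ ω_h^m(T)`. -/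
def AssumptionA1 {γ : ℝ → Plane} {a b : ℝ} (Γ : Set Plane) (𝒯 : Mesh γ a b)
    (X : Submodule ℝ (Plane → ℝ)) (m : ℕ) (ψ : Fin 𝒯.n → Plane → ℝ) : Prop :=
  ∀ j : Fin 𝒯.n, ψ j ∈ X ∧ IsConnected (suppOn Γ (ψ j)) ∧
    𝒯.element j ⊆ suppOn Γ (ψ j) ∧ suppOn Γ (ψ j) ⊆ 𝒯.patch j m

/-- Assumption (A2): `‖1 - ψ_T‖²_{L²(supp ψ_T)} ≤ (1 - q) |supp ψ_T|` for all elements `T`. -/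
def AssumptionA2 {γ : ℝ → Plane} {a b : ℝ} (Γ : Set Plane) (𝒯 : Mesh γ a b)
    (q : ℝ) (ψ : Fin 𝒯.n → Plane → ℝ) : Prop :=
  ∀ j : Fin 𝒯.n, l2NormSq (suppOn Γ (ψ j)) (fun x => 1 - ψ j x) ≤
    ENNReal.ofReal (1 - q) * μH[1] (suppOn Γ (ψ j))

end FaermannBEM

end

open FaermannBEM

/-! Split the double integral over `Γ × Γ` according to whether `x` and `y` lie in elements that
meet. Elements that meet share a node, and a node lies in boundedly many elements, so the near pairs
are controlled by the node patches (`Mesh.sum_pairSemiSq_le`). For far pairs, `(u x - u y)² ≤ 2 (u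
x)² + 2 (u y)²`, and the kernel `|x - y|⁻²` integrated over points at distance `≳ h_T` is `≲ 1 /
h_T`. What remains is the scaled norm `∑ h_T⁻¹ ‖u‖²_{L²(T)}` (`seminorm_le_near_add_scaledL2`),
which also bounds the full `L²` norm.

The orthogonality controls the scaled norm. On `ω = supp ψ_T` the oscillation of `u` equals `2 |ω|
∫u² - 2 (∫u)²`, and `(∫u)² = (∫u (1 - ψ_T))² ≤ (1 - q) |ω| ∫u²` by Cauchy-Schwarz; so `2 q |ω| ∫u²`
is at most the oscillation (`lintegral_sq_le_sqOsc`). The oscillation over `ω` is a sum over pairs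
of elements of a patch of order `m`. Divided by the lengths, it obeys a quasi-triangle inequality,
so walks through neighbours reduce it to pairs of elements that meet
(`sum_ball_ball_quasimetric_le`, `scaledL2_le`). There `|x - y| ≤ h_T + h_{T'}`, and the local
seminorm takes over.

The curve enters through `IsChordArc`: finite length, linear growth, and arcs no longer than `D |x -
y|`. Since there are no cusps, the parametrization is bi-Lipschitz up to identifying the end points.
An arc joining elements that do not meet contains a whole neighbour of the first
(`Mesh.exists_element_subset`), whence `h_T ≤ κ D |x - y|`. The constant `D` refers to `Γ` alone, so
`C₃` can be chosen before the parametrization. -/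

noncomputable section

namespace FaermannBEM

/-! ### Mean square oscillation -/

section Oscillation

variable {X : Type*}

/-- The squared difference of the values of `u` at two points, with values in `[0,∞]`. -/
def sqDiff (u : X → ℝ) (x y : X) : ℝ≥0∞ := ENNReal.ofReal ((u x - u y) ^ 2)

theorem sqDiff_comm (u : X → ℝ) (x y : X) : sqDiff u x y = sqDiff u y x := by
  unfold sqDiff; congr 1; ring

theorem sqDiff_triangle (u : X → ℝ) (x y z : X) :
    sqDiff u x z ≤ 2 * sqDiff u x y + 2 * sqDiff u y z := by
  unfold sqDiff
  rw [← ENNReal.ofReal_ofNat 2, ← ENNReal.ofReal_mul (by norm_num),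
    ← ENNReal.ofReal_mul (by norm_num), ← ENNReal.ofReal_add (by positivity) (by positivity)]
  apply ENNReal.ofReal_le_ofReal
  nlinarith [sq_nonneg ((u x - u y) - (u y - u z))]

variable [MeasurableSpace X]

/-- The squared differences of the values of `u`, integrated over a product measure. -/
def sqOsc (u : X → ℝ) (α β : Measure X) : ℝ≥0∞ := ∫⁻ x, ∫⁻ y, sqDiff u x y ∂β ∂α

theorem measurable_sqDiff {u : X → ℝ} (hu : Measurable u) :
    Measurable (fun p : X × X => sqDiff u p.1 p.2) := by
  unfold sqDiff
  fun_prop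

theorem measurable_sqDiff_left {u : X → ℝ} (hu : Measurable u) (y : X) :
    Measurable (fun x => sqDiff u x y) := by
  unfold sqDiff
  fun_prop

theorem measurable_sqDiff_right {u : X → ℝ} (hu : Measurable u) (x : X) :
    Measurable (fun y => sqDiff u x y) := by
  unfold sqDiff
  fun_prop

theorem measurable_lintegral_sqDiff {u : X → ℝ} (hu : Measurable u) (β : Measure X) [SFinite β] :
    Measurable (fun x => ∫⁻ y, sqDiff u x y ∂β) :=
  (measurable_sqDiff hu).lintegral_prod_right'

theorem sqOsc_comm {u : X → ℝ} (hu : Measurable u) (α β : Measure X) [SFinite α] [SFinite β] :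
    sqOsc u α β = sqOsc u β α := by
  unfold sqOsc
  rw [lintegral_lintegral_swap (measurable_sqDiff hu).aemeasurable]
  simp_rw [fun y x => sqDiff_comm u y x]

/-- Insert an intermediate point and average it over `β`. Total mass one for all three measures is
what makes the constants independent of their supports. -/
theorem sqOsc_triangle {u : X → ℝ} (hu : Measurable u) (α β δ : Measure X)
    [IsProbabilityMeasure α] [IsProbabilityMeasure β] [IsProbabilityMeasure δ] :
    sqOsc u α δ ≤ 2 * sqOsc u α β + 2 * sqOsc u β δ := by
  calc sqOsc u α δ = ∫⁻ x, ∫⁻ z, ∫⁻ _y, sqDiff u x z ∂β ∂δ ∂α := by simp [sqOsc]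
    _ ≤ ∫⁻ x, ∫⁻ z, ∫⁻ y, (2 * sqDiff u x y + 2 * sqDiff u y z) ∂β ∂δ ∂α := by
        gcongr with x z y
        exact sqDiff_triangle u x y z
    _ = ∫⁻ x, (2 * (∫⁻ y, sqDiff u x y ∂β) + 2 * ∫⁻ z, ∫⁻ y, sqDiff u y z ∂β ∂δ) ∂α := by
        congr 1; ext x
        have h1 : ∀ z, ∫⁻ y, (2 * sqDiff u x y + 2 * sqDiff u y z) ∂β =
            2 * (∫⁻ y, sqDiff u x y ∂β) + 2 * ∫⁻ y, sqDiff u y z ∂β := fun z => by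
          rw [lintegral_add_left ((measurable_sqDiff_right hu x).const_mul 2),
            lintegral_const_mul _ (measurable_sqDiff_right hu x),
            lintegral_const_mul _ (measurable_sqDiff_left hu z)]
        simp_rw [h1]
        rw [lintegral_add_left measurable_const, lintegral_const, measure_univ, mul_one,
          lintegral_const_mul]
        simp_rw [fun y z => sqDiff_comm u y z]
        exact measurable_lintegral_sqDiff hu β
    _ = 2 * sqOsc u α β + 2 * sqOsc u δ β := by
        rw [lintegral_add_right _ measurable_const, lintegral_const, measure_univ, mul_one,
          lintegral_const_mul _ (measurable_lintegral_sqDiff hu β)]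
        simp_rw [fun y z => sqDiff_comm u y z]
        rfl
    _ = 2 * sqOsc u α β + 2 * sqOsc u β δ := by rw [sqOsc_comm hu δ β]

/-- The variance identity: the oscillation over a finite measure in terms of moments. -/
theorem sqOsc_self {u : X → ℝ} {μ : Measure X} [IsFiniteMeasure μ] (hu : MemLp u 2 μ) :
    sqOsc u μ μ = ENNReal.ofReal (2 * μ.real univ * ∫ x, u x ^ 2 ∂μ - 2 * (∫ x, u x ∂μ) ^ 2) := by
  have hi : Integrable u μ := hu.integrable (by norm_num)
  have hs : Integrable (fun x => u x ^ 2) μ := hu.integrable_sq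
  have hy : ∀ x, Integrable (fun y => (u x - u y) ^ 2) μ := fun x =>
    ((memLp_const (u x)).sub hu).integrable_sq
  have hin : ∀ x, ∫ y, (u x - u y) ^ 2 ∂μ =
      μ.real univ * u x ^ 2 - 2 * (∫ y, u y ∂μ) * u x + ∫ y, u y ^ 2 ∂μ := fun x => by
    have : ∀ y, (u x - u y) ^ 2 = (u x ^ 2 - 2 * u x * u y) + u y ^ 2 := fun y => by ring
    simp_rw [this]
    rw [integral_add (show Integrable (fun y => u x ^ 2 - 2 * u x * u y) μ from
        (integrable_const _).sub (hi.const_mul _)) hs,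
      integral_sub (integrable_const _) (hi.const_mul _), integral_const, integral_const_mul]
    simp only [smul_eq_mul]; ring
  have hI : ∀ x, ∫⁻ y, sqDiff u x y ∂μ = ENNReal.ofReal (∫ y, (u x - u y) ^ 2 ∂μ) := fun x => by
    rw [ofReal_integral_eq_lintegral_ofReal (hy x) (ae_of_all _ fun y => sq_nonneg _)]
    rfl
  unfold sqOsc
  simp_rw [hI]
  rw [← ofReal_integral_eq_lintegral_ofReal]
  · congr 1
    simp_rw [hin]
    rw [integral_add (show Integrable (fun x => μ.real univ * u x ^ 2 - 2 * (∫ y, u y ∂μ) * u x) μ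
        from (hs.const_mul _).sub (hi.const_mul _)) (integrable_const _),
      integral_sub (hs.const_mul _) (hi.const_mul _), integral_const, integral_const_mul,
      integral_const_mul]
    simp only [smul_eq_mul]; ring
  · simp_rw [hin]
    exact ((hs.const_mul _).sub (hi.const_mul _)).add (integrable_const _)
  · exact ae_of_all _ fun x => integral_nonneg fun y => sq_nonneg _

/-- A function that is orthogonal to a function close to `1` is bounded by its oscillation. -/
theorem lintegral_sq_le_sqOsc {u ψ : X → ℝ} {μ : Measure X} [IsFiniteMeasure μ]
    (hu : MemLp u 2 μ) (hψ : MemLp ψ 2 μ) {q : ℝ} (hq : q ≤ 1)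
    (horth : ∫ x, u x * ψ x ∂μ = 0)
    (hnear : ∫⁻ x, ENNReal.ofReal ((1 - ψ x) ^ 2) ∂μ ≤ ENNReal.ofReal (1 - q) * μ univ) :
    ENNReal.ofReal (2 * q) * μ univ * ∫⁻ x, ENNReal.ofReal (u x ^ 2) ∂μ ≤ sqOsc u μ μ := by
  have hi : Integrable u μ := hu.integrable (by norm_num)
  have hs : Integrable (fun x => u x ^ 2) μ := hu.integrable_sq
  have hψ1 : MemLp (fun x => 1 - ψ x) 2 μ := (memLp_const (1 : ℝ)).sub hψ
  have hψs : Integrable (fun x => (1 - ψ x) ^ 2) μ := hψ1.integrable_sq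
  have hnear' : ∫ x, (1 - ψ x) ^ 2 ∂μ ≤ (1 - q) * μ.real univ := by
    rw [← ofReal_integral_eq_lintegral_ofReal hψs (ae_of_all _ fun x => sq_nonneg _)] at hnear
    rw [← ofReal_measureReal, ← ENNReal.ofReal_mul (by linarith)] at hnear
    exact (ENNReal.ofReal_le_ofReal_iff (mul_nonneg (by linarith) measureReal_nonneg)).1 hnear
  have huψ : Integrable (fun x => u x * ψ x) μ := hu.integrable_mul hψ
  -- Orthogonality to `ψ` trades the weight `1` for the small weight `1 - ψ`.
  have hmean : ∫ x, u x ∂μ = ∫ x, u x * (1 - ψ x) ∂μ := by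
    have : ∀ x, u x * (1 - ψ x) = u x - u x * ψ x := fun x => by ring
    simp_rw [this]
    rw [integral_sub hi huψ, horth, sub_zero]
  have hcs : (∫ x, u x * (1 - ψ x) ∂μ) ^ 2 ≤ (∫ x, u x ^ 2 ∂μ) * ∫ x, (1 - ψ x) ^ 2 ∂μ := by
    have hm : Integrable (fun x => u x * (1 - ψ x)) μ := hu.integrable_mul hψ1
    set A := ∫ x, u x ^ 2 ∂μ
    set B := ∫ x, u x * (1 - ψ x) ∂μ
    set D := ∫ x, (1 - ψ x) ^ 2 ∂μ
    -- Cauchy-Schwarz as the discriminant of the nonnegative quadratic `∫ (s u + (1 - ψ))²` in `s`.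
    have key : ∀ s : ℝ, 0 ≤ A * (s * s) + (2 * B) * s + D := fun s => by
      have h0 : 0 ≤ ∫ x, (s * u x + (1 - ψ x)) ^ 2 ∂μ := integral_nonneg fun x => sq_nonneg _
      have : ∀ x, (s * u x + (1 - ψ x)) ^ 2 =
          (s ^ 2 * u x ^ 2 + (2 * s) * (u x * (1 - ψ x))) + (1 - ψ x) ^ 2 := fun x => by ring
      simp_rw [this] at h0
      rw [integral_add (show Integrable (fun x => s ^ 2 * u x ^ 2 + 2 * s * (u x * (1 - ψ x))) μ
          from (hs.const_mul _).add (hm.const_mul _)) hψs,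
        integral_add (hs.const_mul _) (hm.const_mul _), integral_const_mul,
        integral_const_mul] at h0
      linarith
    have := discrim_le_zero key
    unfold discrim at this
    linarith
  rw [sqOsc_self hu, ← ofReal_integral_eq_lintegral_ofReal hs (ae_of_all _ fun x => sq_nonneg _),
    ← ofReal_measureReal (μ := μ) (s := univ)]
  rcases le_or_gt q 0 with h0 | h0
  · simp [ENNReal.ofReal_of_nonpos (show 2 * q ≤ 0 by linarith)]
  rw [← ENNReal.ofReal_mul (by linarith),
    ← ENNReal.ofReal_mul (mul_nonneg (by linarith) measureReal_nonneg)]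
  apply ENNReal.ofReal_le_ofReal
  have hA : 0 ≤ ∫ x, u x ^ 2 ∂μ := integral_nonneg fun x => sq_nonneg _
  have := mul_le_mul_of_nonneg_left hnear' hA
  rw [← hmean] at hcs
  nlinarith

end Oscillation

/-! ### Sums over balls in a graph of bounded degree -/

section Graph

variable {ι : Type*} [Fintype ι] (r : ι → ι → Prop)

open Classical in
/-- The indices related to `i`. -/
def nbhd (i : ι) : Finset ι := Finset.univ.filter (r i)

open Classical in
/-- The indices that can be reached from `j` by a walk of length `m`. -/
def ball (j : ι) : ℕ → Finset ι
  | 0 => {j}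
  | m + 1 => (ball j m).biUnion (nbhd r)

variable {r}

theorem mem_nbhd {i k : ι} : k ∈ nbhd r i ↔ r i k := by simp [nbhd]

theorem mem_ball_zero {i j : ι} : i ∈ ball r j 0 ↔ i = j := by simp [ball]

theorem mem_ball_succ {i j : ι} {m : ℕ} :
    i ∈ ball r j (m + 1) ↔ ∃ k ∈ ball r j m, r k i := by
  simp [ball, mem_nbhd]

theorem sum_sum_nbhd_comm (hr : ∀ i k, r i k → r k i) (F : ι → ι → ℝ≥0∞) :
    ∑ j, ∑ i ∈ nbhd r j, F j i = ∑ i, ∑ j ∈ nbhd r i, F j i := by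
  classical
  refine Finset.sum_comm' fun x y => ?_
  simp only [Finset.mem_univ, true_and, and_true, mem_nbhd]
  exact ⟨hr _ _, hr _ _⟩

/-- Double counting: by symmetry `f i` appears once for each neighbour of `i`. -/
theorem sum_sum_nbhd_le (hr : ∀ i k, r i k → r k i) {d : ℕ} (hd : ∀ i, (nbhd r i).card ≤ d)
    (f : ι → ℝ≥0∞) : ∑ j, ∑ i ∈ nbhd r j, f i ≤ d * ∑ j, f j := by
  rw [sum_sum_nbhd_comm hr, Finset.mul_sum]
  refine Finset.sum_le_sum fun i _ => ?_
  rw [Finset.sum_const, nsmul_eq_mul]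
  gcongr
  exact hd i

theorem sum_ball_succ_le (j : ι) (m : ℕ) (f : ι → ℝ≥0∞) :
    ∑ i ∈ ball r j (m + 1), f i ≤ ∑ k ∈ ball r j m, ∑ i ∈ nbhd r k, f i := by
  classical
  change ∑ i ∈ (ball r j m).biUnion (nbhd r), f i ≤ _
  generalize ball r j m = s
  induction s using Finset.induction_on with
  | empty => simp
  | insert k s hk ih =>
    rw [Finset.biUnion_insert, Finset.sum_insert hk]
    refine le_trans ?_ (add_le_add_right ih _)
    rw [← Finset.sum_union_inter]
    exact le_self_add

theorem sum_sum_ball_le (hr : ∀ i k, r i k → r k i) {d : ℕ} (hd : ∀ i, (nbhd r i).card ≤ d)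
    (m : ℕ) (f : ι → ℝ≥0∞) : ∑ j, ∑ i ∈ ball r j m, f i ≤ d ^ m * ∑ j, f j := by
  induction m generalizing f with
  | zero => simp [ball]
  | succ m ih =>
    calc ∑ j, ∑ i ∈ ball r j (m + 1), f i
        ≤ ∑ j, ∑ k ∈ ball r j m, ∑ i ∈ nbhd r k, f i :=
          Finset.sum_le_sum fun j _ => sum_ball_succ_le j m f
      _ ≤ d ^ m * ∑ j, ∑ i ∈ nbhd r j, f i := ih _
      _ ≤ d ^ m * (d * ∑ j, f j) := by gcongr; exact sum_sum_nbhd_le hr hd f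
      _ = d ^ (m + 1) * ∑ j, f j := by rw [pow_succ, mul_assoc]

theorem card_ball_le {d : ℕ} (hd : ∀ i, (nbhd r i).card ≤ d) (j : ι) (m : ℕ) :
    (ball r j m).card ≤ d ^ m := by
  classical
  induction m with
  | zero => simp [ball]
  | succ m ih =>
    calc (ball r j (m + 1)).card ≤ (ball r j m).card * d :=
          Finset.card_biUnion_le_card_mul _ _ _ fun i _ => hd i
      _ ≤ d ^ (m + 1) := by rw [pow_succ]; gcongr

/-- Split off the last step `k → i` of a walk from `j`. The part `e j k` recurs with factor `2 d`,
and the part `e k i` is counted at most `d ^ m` times. No vanishing of `e j j` is assumed, so walks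
of length zero are absorbed by reflexivity. -/
theorem sum_ball_quasimetric_le (hr : ∀ i k, r i k → r k i) (hrefl : ∀ i, r i i) {d : ℕ}
    (hd : ∀ i, (nbhd r i).card ≤ d) {e : ι → ι → ℝ≥0∞}
    (htri : ∀ i j k, e i k ≤ 2 * e i j + 2 * e j k) (m : ℕ) :
    ∑ j, ∑ i ∈ ball r j m, e j i ≤ (2 * d + 2) ^ m * ∑ j, ∑ i ∈ nbhd r j, e j i := by
  induction m with
  | zero =>
    simp only [ball, Finset.sum_singleton, pow_zero, one_mul]
    exact Finset.sum_le_sum fun j _ =>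
      Finset.single_le_sum (f := fun i => e j i) (fun _ _ => zero_le) (mem_nbhd.2 (hrefl j))
  | succ m ih =>
    set w := ∑ j, ∑ i ∈ nbhd r j, e j i
    calc ∑ j, ∑ i ∈ ball r j (m + 1), e j i
        ≤ ∑ j, ∑ k ∈ ball r j m, ∑ i ∈ nbhd r k, e j i :=
          Finset.sum_le_sum fun j _ => sum_ball_succ_le j m _
      _ ≤ ∑ j, ∑ k ∈ ball r j m, (2 * d * e j k + 2 * ∑ i ∈ nbhd r k, e k i) := by
          refine Finset.sum_le_sum fun j _ => Finset.sum_le_sum fun k _ => ?_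
          calc ∑ i ∈ nbhd r k, e j i ≤ ∑ i ∈ nbhd r k, (2 * e j k + 2 * e k i) :=
                Finset.sum_le_sum fun i _ => htri j k i
            _ = (nbhd r k).card * (2 * e j k) + 2 * ∑ i ∈ nbhd r k, e k i := by
                rw [Finset.sum_add_distrib, Finset.sum_const, nsmul_eq_mul, Finset.mul_sum]
            _ ≤ d * (2 * e j k) + 2 * ∑ i ∈ nbhd r k, e k i := by gcongr; exact hd k
            _ = _ := by ring
      _ = 2 * d * (∑ j, ∑ k ∈ ball r j m, e j k) +
            2 * ∑ j, ∑ k ∈ ball r j m, ∑ i ∈ nbhd r k, e k i := by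
          simp_rw [Finset.sum_add_distrib, Finset.mul_sum]
      _ ≤ 2 * d * ((2 * d + 2) ^ m * w) + 2 * (d ^ m * w) := by
          gcongr
          exact sum_sum_ball_le hr hd m _
      _ ≤ 2 * d * ((2 * d + 2) ^ m * w) + 2 * ((2 * d + 2) ^ m * w) := by
          gcongr
          calc (d : ℝ≥0∞) ≤ d + (d + 2) := le_self_add
            _ = 2 * d + 2 := by ring
      _ = (2 * d + 2) ^ (m + 1) * w := by ring

/-- Two indices of one ball are compared through its centre, which leaves distances to the centre
times the cardinality of the ball. -/
theorem sum_ball_ball_quasimetric_le (hr : ∀ i k, r i k → r k i) (hrefl : ∀ i, r i i) {d : ℕ}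
    (hd : ∀ i, (nbhd r i).card ≤ d) {e : ι → ι → ℝ≥0∞} (hsymm : ∀ i j, e i j = e j i)
    (htri : ∀ i j k, e i k ≤ 2 * e i j + 2 * e j k) (m : ℕ) :
    ∑ j, ∑ i ∈ ball r j m, ∑ k ∈ ball r j m, e i k ≤
      4 * d ^ m * (2 * d + 2) ^ m * ∑ j, ∑ i ∈ nbhd r j, e j i := by
  calc ∑ j, ∑ i ∈ ball r j m, ∑ k ∈ ball r j m, e i k
      ≤ ∑ j, ∑ i ∈ ball r j m, ∑ k ∈ ball r j m, (2 * e j i + 2 * e j k) := by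
        gcongr with j _ i _ k _
        rw [hsymm j i]
        exact htri i j k
    _ = ∑ j, 4 * (ball r j m).card * ∑ i ∈ ball r j m, e j i := by
        refine Finset.sum_congr rfl fun j _ => ?_
        simp_rw [Finset.sum_add_distrib, Finset.sum_const, ← Finset.mul_sum, nsmul_eq_mul]
        rw [← Finset.mul_sum, ← Finset.mul_sum]
        ring
    _ ≤ ∑ j, 4 * d ^ m * ∑ i ∈ ball r j m, e j i := by
        gcongr with j _
        exact_mod_cast card_ball_le hd j m
    _ = 4 * d ^ m * ∑ j, ∑ i ∈ ball r j m, e j i := by rw [Finset.mul_sum]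
    _ ≤ 4 * d ^ m * ((2 * d + 2) ^ m * ∑ j, ∑ i ∈ nbhd r j, e j i) := by
        gcongr
        exact sum_ball_quasimetric_le hr hrefl hd htri m
    _ = _ := by ring

theorem le_pow_mul_of_mem_ball {f : ι → ℝ≥0∞} {κ : ℝ≥0∞} (hf : ∀ i k, r i k → f k ≤ κ * f i)
    {j i : ι} {m : ℕ} (hi : i ∈ ball r j m) : f i ≤ κ ^ m * f j := by
  induction m generalizing i with
  | zero => simp [mem_ball_zero.1 hi]
  | succ m ih =>
    obtain ⟨k, hk, hki⟩ := mem_ball_succ.1 hi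
    calc f i ≤ κ * f k := hf k i hki
      _ ≤ κ * (κ ^ m * f j) := by gcongr; exact ih hk
      _ = κ ^ (m + 1) * f j := by ring

end Graph

/-! ### Localization of the Sobolev-Slobodeckij norm for an abstract mesh -/

section Localization

/-- The integrand of the Sobolev-Slobodeckij seminorm. -/
def diffQuot (u : Plane → ℝ) (x y : Plane) : ℝ≥0∞ :=
  ENNReal.ofReal ((u x - u y) ^ 2 / ‖x - y‖ ^ 2)

theorem measurable_diffQuot {u : Plane → ℝ} (hu : Measurable u) :
    Measurable (fun p : Plane × Plane => diffQuot u p.1 p.2) := by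
  unfold diffQuot
  fun_prop

theorem sqDiff_le_diffQuot (u : Plane → ℝ) (x y : Plane) :
    sqDiff u x y ≤ edist x y ^ 2 * diffQuot u x y := by
  rcases eq_or_ne x y with rfl | h
  · simp [sqDiff]
  · have h0 : ‖x - y‖ ≠ 0 := norm_ne_zero_iff.2 (sub_ne_zero.2 h)
    unfold sqDiff diffQuot
    rw [edist_dist, dist_eq_norm, ← ENNReal.ofReal_pow (norm_nonneg _),
      ← ENNReal.ofReal_mul (by positivity)]
    apply ENNReal.ofReal_le_ofReal
    field_simp
    exact le_rfl

theorem diffQuot_le (u : Plane → ℝ) (x y : Plane) :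
    diffQuot u x y ≤ 2 * (ENNReal.ofReal (u x ^ 2) * (edist x y ^ 2)⁻¹) +
      2 * (ENNReal.ofReal (u y ^ 2) * (edist x y ^ 2)⁻¹) := by
  rcases eq_or_ne x y with rfl | h
  · simp [diffQuot]
  · have h0 : 0 < ‖x - y‖ := norm_pos_iff.2 (sub_ne_zero.2 h)
    have h2 : ∀ t : ℝ, 2 * ENNReal.ofReal t = ENNReal.ofReal (2 * t) := fun t => by
      rw [ENNReal.ofReal_mul (by norm_num), ENNReal.ofReal_ofNat]
    unfold diffQuot
    rw [edist_dist, dist_eq_norm, ← ENNReal.ofReal_pow (norm_nonneg _),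
      ← ENNReal.ofReal_inv_of_pos (by positivity), ← ENNReal.ofReal_mul (by positivity),
      ← ENNReal.ofReal_mul (by positivity), h2, h2,
      ← ENNReal.ofReal_add (by positivity) (by positivity)]
    apply ENNReal.ofReal_le_ofReal
    rw [div_eq_mul_inv]
    have : 0 ≤ (‖x - y‖ ^ 2)⁻¹ := by positivity
    nlinarith [mul_nonneg (sq_nonneg (u x + u y)) this]

/-- The kernel `|x - y|⁻²` is integrable off a ball for a measure of linear growth. -/
theorem lintegral_inv_edist_sq_le {X : Type*} [PseudoEMetricSpace X] [MeasurableSpace X]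
    {μ : Measure X} {x : X} {M : ℝ≥0∞}
    (hM : ∀ ρ : ℝ≥0∞, ρ ≠ 0 → μ {y | edist x y ≤ ρ} ≤ M * ρ) (hfin : ∀ y, edist x y ≠ ∞)
    {ρ : ℝ≥0∞} (h0 : ρ ≠ 0) (ht : ρ ≠ ∞) :
    ∫⁻ y in {y | ρ ≤ edist x y}, (edist x y ^ 2)⁻¹ ∂μ ≤ 4 * M * ρ⁻¹ := by
  -- Dyadic annuli: the `k`-th one contributes at most `2 M ρ⁻¹ 2⁻ᵏ`, and the geometric series
  -- doubles the constant. The least `k` whose outer radius reaches `y` selects the annulus of `y`.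
  have hcover : {y | ρ ≤ edist x y} ⊆
      ⋃ k : ℕ, {y | 2 ^ k * ρ ≤ edist x y ∧ edist x y ≤ 2 ^ (k + 1) * ρ} := by
    intro y hy
    have hex : ∃ k : ℕ, edist x y ≤ 2 ^ (k + 1) * ρ := by
      obtain ⟨n, hn⟩ := ENNReal.exists_nat_gt (ENNReal.div_ne_top (hfin y) h0)
      refine ⟨n, ?_⟩
      have h2 : (n : ℝ≥0∞) ≤ 2 ^ (n + 1) := by
        exact_mod_cast (Nat.lt_two_pow_self.le.trans (Nat.pow_le_pow_right (by norm_num)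
          (Nat.le_succ n)))
      exact (ENNReal.div_le_iff h0 ht).1 (hn.le.trans h2)
    classical
    refine mem_iUnion.2 ⟨Nat.find hex, ?_, Nat.find_spec hex⟩
    rcases hk : Nat.find hex with _ | k
    · simpa using hy
    · have := Nat.find_min hex (m := k) (by omega)
      exact (not_le.1 this).le
  have hpiece : ∀ k : ℕ,
      ∫⁻ y in {y | 2 ^ k * ρ ≤ edist x y ∧ edist x y ≤ 2 ^ (k + 1) * ρ}, (edist x y ^ 2)⁻¹ ∂μ ≤
        2 * M * ρ⁻¹ * (2⁻¹) ^ k := by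
    intro k
    have hc0 : (2 : ℝ≥0∞) ^ k ≠ 0 := by simp
    have hct : (2 : ℝ≥0∞) ^ k ≠ ∞ := by finiteness
    calc _ ≤ ∫⁻ _y in {y | 2 ^ k * ρ ≤ edist x y ∧ edist x y ≤ 2 ^ (k + 1) * ρ},
          ((2 ^ k * ρ) ^ 2)⁻¹ ∂μ := by
          refine setLIntegral_mono measurable_const fun y hy => ?_
          have := hy.1
          gcongr
      _ = ((2 ^ k * ρ) ^ 2)⁻¹ *
          μ {y | 2 ^ k * ρ ≤ edist x y ∧ edist x y ≤ 2 ^ (k + 1) * ρ} := by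
          rw [setLIntegral_const]
      _ ≤ ((2 ^ k * ρ) ^ 2)⁻¹ * (M * (2 ^ (k + 1) * ρ)) := by
          gcongr
          refine (measure_mono fun y hy => hy.2).trans (hM _ ?_)
          simp [h0]
      _ = 2 * M * ρ⁻¹ * (2⁻¹) ^ k := by
          have e1 : ((2 ^ k * ρ) ^ 2)⁻¹ = ((2 : ℝ≥0∞) ^ k)⁻¹ * ((2 : ℝ≥0∞) ^ k)⁻¹ * ρ⁻¹ * ρ⁻¹ := by
            rw [sq, ENNReal.mul_inv (Or.inr (by finiteness)) (Or.inr (by simp [h0])),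
              ENNReal.mul_inv (Or.inl hc0) (Or.inl hct)]
            ring
          rw [e1, ← ENNReal.inv_pow, pow_succ]
          calc _ = (((2 : ℝ≥0∞) ^ k)⁻¹ * 2 ^ k) * (ρ⁻¹ * ρ) *
                (2 * M * ρ⁻¹ * ((2 : ℝ≥0∞) ^ k)⁻¹) := by ring
            _ = _ := by
                rw [ENNReal.inv_mul_cancel hc0 hct, ENNReal.inv_mul_cancel h0 ht, one_mul,
                  one_mul]
  calc _ ≤ ∫⁻ y in ⋃ k : ℕ, {y | 2 ^ k * ρ ≤ edist x y ∧ edist x y ≤ 2 ^ (k + 1) * ρ},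
        (edist x y ^ 2)⁻¹ ∂μ := lintegral_mono_set hcover
    _ ≤ ∑' k : ℕ, ∫⁻ y in {y | 2 ^ k * ρ ≤ edist x y ∧ edist x y ≤ 2 ^ (k + 1) * ρ},
        (edist x y ^ 2)⁻¹ ∂μ := lintegral_iUnion_le _ _
    _ ≤ ∑' k : ℕ, 2 * M * ρ⁻¹ * (2⁻¹) ^ k := ENNReal.tsum_le_tsum hpiece
    _ = 4 * M * ρ⁻¹ := by
        rw [ENNReal.tsum_mul_left, ENNReal.tsum_geometric]
        have : (1 - 2⁻¹ : ℝ≥0∞)⁻¹ = 2 := by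
          rw [ENNReal.one_sub_inv_two, inv_inv]
        rw [this]; ring

theorem restrict_biUnion_finset_le {X ι : Type*} [MeasurableSpace X] (μ : Measure X)
    (s : Finset ι) (T : ι → Set X) {ω : Set X} (hω : ω ⊆ ⋃ i ∈ s, T i) :
    μ.restrict ω ≤ ∑ i ∈ s, μ.restrict (T i) := by
  classical
  refine (Measure.restrict_mono hω le_rfl).trans ?_
  induction s using Finset.induction_on generalizing ω with
  | empty => simp
  | insert k s hk ih =>
    rw [Finset.set_biUnion_insert, Finset.sum_insert hk]
    exact (Measure.restrict_union_le _ _).trans (add_le_add_right (ih subset_rfl) _)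

theorem sqOsc_restrict_le {X ι : Type*} [MeasurableSpace X] (μ : Measure X) [SFinite μ]
    {u : X → ℝ} (hu : Measurable u) (s : Finset ι) (T : ι → Set X) {ω : Set X} (hω : ω ⊆ ⋃ i ∈ s, T i) :
    sqOsc u (μ.restrict ω) (μ.restrict ω) ≤
      ∑ i ∈ s, ∑ k ∈ s, sqOsc u (μ.restrict (T i)) (μ.restrict (T k)) := by
  have hle := restrict_biUnion_finset_le μ s T hω
  calc sqOsc u (μ.restrict ω) (μ.restrict ω)
      ≤ ∫⁻ x, ∑ k ∈ s, ∫⁻ y in T k, sqDiff u x y ∂μ ∂(∑ i ∈ s, μ.restrict (T i)) := by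
        refine lintegral_mono' hle fun x => ?_
        rw [← lintegral_finsetSum_measure]
        exact lintegral_mono' hle le_rfl
    _ = _ := by
        rw [lintegral_finsetSum_measure]
        refine Finset.sum_congr rfl fun i _ => ?_
        rw [lintegral_finsetSum _ fun k _ => measurable_lintegral_sqDiff hu _]
        rfl

variable {ι : Type*}

/-- The relation of indices whose sets meet. -/
def Meets {X : Type*} (T : ι → Set X) (i k : ι) : Prop := (T i ∩ T k).Nonempty

theorem Meets.symm {X : Type*} {T : ι → Set X} {i k : ι} (h : Meets T i k) : Meets T k i := by
  unfold Meets; rwa [inter_comm]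

variable [Fintype ι]

/-- The double integral of the Sobolev-Slobodeckij seminorm over a product `A × B`. -/
def pairSemiSq (μ : Measure Plane) (u : Plane → ℝ) (A B : Set Plane) : ℝ≥0∞ :=
  ∫⁻ x in A, ∫⁻ y in B, diffQuot u x y ∂μ ∂μ

theorem pairSemiSq_eq_prod {μ : Measure Plane} [SFinite μ] {u : Plane → ℝ} (hu : Measurable u)
    (A B : Set Plane) :
    pairSemiSq μ u A B = ∫⁻ p in A ×ˢ B, diffQuot u p.1 p.2 ∂(μ.prod μ) := by
  rw [← Measure.prod_restrict, lintegral_prod _ (measurable_diffQuot hu).aemeasurable]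
  rfl

/-- Bounding the squared difference by `2 (u x)² + 2 (u y)²` gives two integrals, which agree after
swapping the variables because `F` is symmetric; hence the factor `4`. -/
theorem lintegral_compl_diffQuot_le {μ : Measure Plane} [SFinite μ] {u : Plane → ℝ}
    (hu : Measurable u) {F : Set (Plane × Plane)} (hF : MeasurableSet F)
    (hFs : ∀ x y, (x, y) ∈ F → (y, x) ∈ F) :
    ∫⁻ p in F, diffQuot u p.1 p.2 ∂(μ.prod μ) ≤
      4 * ∫⁻ x, ENNReal.ofReal (u x ^ 2) *
        ∫⁻ y in {y | (x, y) ∈ F}, (edist x y ^ 2)⁻¹ ∂μ ∂μ := by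
  have hk : Measurable fun p : Plane × Plane =>
      ENNReal.ofReal (u p.1 ^ 2) * (edist p.1 p.2 ^ 2)⁻¹ := by fun_prop
  have hk' : Measurable fun p : Plane × Plane =>
      ENNReal.ofReal (u p.2 ^ 2) * (edist p.1 p.2 ^ 2)⁻¹ := by fun_prop
  have hsw : ∫⁻ p in F, ENNReal.ofReal (u p.2 ^ 2) * (edist p.1 p.2 ^ 2)⁻¹ ∂(μ.prod μ) =
      ∫⁻ p in F, ENNReal.ofReal (u p.1 ^ 2) * (edist p.1 p.2 ^ 2)⁻¹ ∂(μ.prod μ) := by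
    rw [← lintegral_indicator hF, ← lintegral_indicator hF,
      ← lintegral_prod_swap]
    refine lintegral_congr fun p => ?_
    by_cases hp : p ∈ F
    · have hp' : p.swap ∈ F := hFs _ _ hp
      simp [hp, hp', edist_comm]
    · have hp' : p.swap ∉ F := fun h => hp (hFs _ _ h)
      simp [hp, hp']
  calc ∫⁻ p in F, diffQuot u p.1 p.2 ∂(μ.prod μ)
      ≤ ∫⁻ p in F, (2 * (ENNReal.ofReal (u p.1 ^ 2) * (edist p.1 p.2 ^ 2)⁻¹) +
          2 * (ENNReal.ofReal (u p.2 ^ 2) * (edist p.1 p.2 ^ 2)⁻¹)) ∂(μ.prod μ) :=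
        lintegral_mono fun p => diffQuot_le u p.1 p.2
    _ = 4 * ∫⁻ p in F, ENNReal.ofReal (u p.1 ^ 2) * (edist p.1 p.2 ^ 2)⁻¹ ∂(μ.prod μ) := by
        rw [lintegral_add_left (hk.const_mul 2), lintegral_const_mul _ hk,
          lintegral_const_mul _ hk', hsw]
        ring
    _ = _ := by
        rw [← lintegral_indicator hF, lintegral_prod _ (hk.indicator hF).aemeasurable]
        congr 1
        refine lintegral_congr fun x => ?_
        have hs : MeasurableSet {y | (x, y) ∈ F} := measurable_prodMk_left hF
        rw [← lintegral_const_mul _ (by fun_prop), ← lintegral_indicator hs]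
        rfl

/-- The pairs of points that lie in a common pair of intersecting sets. -/
def nearPairs {X : Type*} (T : ι → Set X) : Set (X × X) :=
  ⋃ i ∈ (Finset.univ : Finset ι), ⋃ k ∈ nbhd (Meets T) i, T i ×ˢ T k

theorem mem_nearPairs {X : Type*} {T : ι → Set X} {x y : X} :
    (x, y) ∈ nearPairs T ↔ ∃ i k, Meets T i k ∧ x ∈ T i ∧ y ∈ T k := by
  simp only [nearPairs, mem_nbhd, mem_iUnion, mem_prod, Finset.mem_univ, exists_prop, true_and]

theorem measurableSet_nearPairs {X : Type*} [MeasurableSpace X] {T : ι → Set X}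
    (hT : ∀ i, MeasurableSet (T i)) : MeasurableSet (nearPairs T) :=
  Finset.measurableSet_biUnion _ fun i _ => Finset.measurableSet_biUnion _ fun k _ =>
    (hT i).prod (hT k)

theorem lintegral_nearPairs_le {μ : Measure Plane} [SFinite μ] {u : Plane → ℝ}
    (hu : Measurable u) (T : ι → Set Plane) :
    ∫⁻ p in nearPairs T, diffQuot u p.1 p.2 ∂(μ.prod μ) ≤
      ∑ i, ∑ k ∈ nbhd (Meets T) i, pairSemiSq μ u (T i) (T k) := by
  calc _ ≤ ∑ i, ∫⁻ p in ⋃ k ∈ nbhd (Meets T) i, T i ×ˢ T k, diffQuot u p.1 p.2 ∂(μ.prod μ) := by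
        rw [← lintegral_finsetSum_measure]
        exact lintegral_mono' (restrict_biUnion_finset_le _ Finset.univ _ subset_rfl) le_rfl
    _ ≤ _ := by
        refine Finset.sum_le_sum fun i _ => ?_
        simp_rw [pairSemiSq_eq_prod hu]
        rw [← lintegral_finsetSum_measure]
        exact lintegral_mono' (restrict_biUnion_finset_le _ _ _ subset_rfl) le_rfl

theorem lintegral_le_sum_setLIntegral {X : Type*} [MeasurableSpace X] {μ : Measure X}
    {T : ι → Set X} (hcover : ∀ᵐ x ∂μ, ∃ i, x ∈ T i) (f : X → ℝ≥0∞) :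
    ∫⁻ x, f x ∂μ ≤ ∑ i, ∫⁻ x in T i, f x ∂μ := by
  have h : μ = μ.restrict (⋃ i, T i) := by
    rw [Measure.restrict_eq_self_of_ae_mem]
    simpa using hcover
  calc ∫⁻ x, f x ∂μ = ∫⁻ x in ⋃ i, T i, f x ∂μ := by rw [← h]
    _ ≤ ∑' i, ∫⁻ x in T i, f x ∂μ := lintegral_iUnion_le _ _
    _ = _ := tsum_fintype _

/-- A mesh-dependent `L²` norm: the `L²` norms on the elements, scaled by the inverse lengths. -/
def scaledL2 (μ : Measure Plane) (u : Plane → ℝ) (T : ι → Set Plane) : ℝ≥0∞ :=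
  ∑ i, (μ (T i))⁻¹ * ∫⁻ x in T i, ENNReal.ofReal (u x ^ 2) ∂μ

theorem lintegral_sq_le_scaledL2 {μ : Measure Plane} [IsFiniteMeasure μ] {u : Plane → ℝ}
    {T : ι → Set Plane} (hcover : ∀ᵐ x ∂μ, ∃ i, x ∈ T i) (hpos : ∀ i, μ (T i) ≠ 0) :
    ∫⁻ x, ENNReal.ofReal (u x ^ 2) ∂μ ≤ μ univ * scaledL2 μ u T := by
  refine (lintegral_le_sum_setLIntegral hcover _).trans ?_
  unfold scaledL2
  rw [Finset.mul_sum]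
  refine Finset.sum_le_sum fun i _ => ?_
  calc _ = μ (T i) * ((μ (T i))⁻¹ * ∫⁻ x in T i, ENNReal.ofReal (u x ^ 2) ∂μ) := by
        rw [← mul_assoc, ENNReal.mul_inv_cancel (hpos i) (by finiteness), one_mul]
    _ ≤ _ := by gcongr; exact subset_univ _

/-- Points of `T i` keep distance at least `μ (T i) / K` from every element not meeting `T i`, so
the kernel integral over far points is at most `4 M K / μ (T i)`. The other factor `4` comes from
separating `u x` and `u y`. -/
theorem seminorm_le_near_add_scaledL2 {μ : Measure Plane} [IsFiniteMeasure μ] {u : Plane → ℝ}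
    (hu : Measurable u) {T : ι → Set Plane} (hT : ∀ i, MeasurableSet (T i))
    (hcover : ∀ᵐ x ∂μ, ∃ i, x ∈ T i) (hpos : ∀ i, μ (T i) ≠ 0) {M K : ℝ≥0∞}
    (hM : ∀ i, ∀ x ∈ T i, ∀ ρ : ℝ≥0∞, ρ ≠ 0 → μ {y | edist x y ≤ ρ} ≤ M * ρ)
    (hK0 : K ≠ 0) (hK1 : K ≠ ∞)
    (hK : ∀ i k, ¬ Meets T i k → ∀ x ∈ T i, ∀ y ∈ T k, μ (T i) ≤ K * edist x y) :
    ∫⁻ x, ∫⁻ y, diffQuot u x y ∂μ ∂μ ≤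
      ∑ i, ∑ k ∈ nbhd (Meets T) i, pairSemiSq μ u (T i) (T k) +
        16 * M * K * scaledL2 μ u T := by
  have hN := measurableSet_nearPairs hT
  have hfar : ∫⁻ p in (nearPairs T)ᶜ, diffQuot u p.1 p.2 ∂(μ.prod μ) ≤
      16 * M * K * scaledL2 μ u T := by
    refine (lintegral_compl_diffQuot_le hu hN.compl fun x y hxy hyx => hxy ?_).trans ?_
    · rw [mem_nearPairs] at hyx ⊢
      obtain ⟨i, k, h, hi, hk⟩ := hyx
      exact ⟨k, i, h.symm, hk, hi⟩
    calc _ ≤ 4 * ∑ i, ∫⁻ x in T i, ENNReal.ofReal (u x ^ 2) *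
          ∫⁻ y in {y | (x, y) ∈ (nearPairs T)ᶜ}, (edist x y ^ 2)⁻¹ ∂μ ∂μ := by
          gcongr
          exact lintegral_le_sum_setLIntegral hcover _
      _ ≤ 4 * ∑ i, ∫⁻ x in T i, ENNReal.ofReal (u x ^ 2) * (4 * M * (μ (T i) / K)⁻¹) ∂μ := by
          refine mul_le_mul' le_rfl (Finset.sum_le_sum fun i _ =>
            setLIntegral_mono' (hT i) fun x hx => mul_le_mul' le_rfl ?_)
          refine le_trans ?_ (lintegral_inv_edist_sq_le (hM i x hx) (fun y => edist_ne_top _ _)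
            (ρ := μ (T i) / K) (ENNReal.div_ne_zero.2 ⟨hpos i, hK1⟩)
            (ENNReal.div_ne_top (by finiteness) hK0))
          refine lintegral_mono' (Measure.restrict_mono_ae ?_) le_rfl
          filter_upwards [hcover] with y hy hxy
          obtain ⟨k, hk⟩ := hy
          refine ENNReal.div_le_of_le_mul' (hK i k (fun h => hxy ?_) x hx y hk)
          exact mem_nearPairs.2 ⟨i, k, h, hx, hk⟩
      _ = _ := by
          unfold scaledL2
          rw [Finset.mul_sum, Finset.mul_sum]
          refine Finset.sum_congr rfl fun i _ => ?_
          rw [lintegral_mul_const _ (by fun_prop), ENNReal.inv_div (Or.inl hK1) (Or.inl hK0),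
            div_eq_mul_inv]
          ring
  calc ∫⁻ x, ∫⁻ y, diffQuot u x y ∂μ ∂μ
      = ∫⁻ p, diffQuot u p.1 p.2 ∂(μ.prod μ) :=
        (lintegral_prod _ (measurable_diffQuot hu).aemeasurable).symm
    _ = _ + _ := (lintegral_add_compl _ hN).symm
    _ ≤ _ := add_le_add (lintegral_nearPairs_le hu T) hfar

end Localization

/-! ### Scaled `L²` norm against the seminorm on neighbouring elements -/

section Comparison

variable {ι : Type*}

/-- The mean of the squared differences of `u` over `T i × T k`. -/
def meanOsc (μ : Measure Plane) (u : Plane → ℝ) (T : ι → Set Plane) (i k : ι) : ℝ≥0∞ :=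
  sqOsc u (ProbabilityTheory.cond μ (T i)) (ProbabilityTheory.cond μ (T k))

theorem meanOsc_eq (μ : Measure Plane) [IsFiniteMeasure μ] (u : Plane → ℝ) {T : ι → Set Plane}
    (hpos : ∀ i, μ (T i) ≠ 0) (i k : ι) :
    meanOsc μ u T i k =
      (μ (T i))⁻¹ * ((μ (T k))⁻¹ * sqOsc u (μ.restrict (T i)) (μ.restrict (T k))) := by
  unfold meanOsc sqOsc ProbabilityTheory.cond
  simp_rw [lintegral_smul_measure, smul_eq_mul]
  rw [lintegral_const_mul' _ _ (ENNReal.inv_ne_top.2 (hpos k))]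

theorem sqOsc_eq_meanOsc (μ : Measure Plane) [IsFiniteMeasure μ] (u : Plane → ℝ)
    {T : ι → Set Plane} (hpos : ∀ i, μ (T i) ≠ 0) (i k : ι) :
    sqOsc u (μ.restrict (T i)) (μ.restrict (T k)) =
      μ (T i) * μ (T k) * meanOsc μ u T i k := by
  rw [meanOsc_eq μ u hpos]
  calc _ = (μ (T i) * (μ (T i))⁻¹) * (μ (T k) * (μ (T k))⁻¹) *
        sqOsc u (μ.restrict (T i)) (μ.restrict (T k)) := by
        rw [ENNReal.mul_inv_cancel (hpos i) (by finiteness),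
          ENNReal.mul_inv_cancel (hpos k) (by finiteness), one_mul, one_mul]
    _ = _ := by ring

/-- Multiplying and dividing by `|x - y|²` costs `(h_i + h_k)²`. For comparable lengths this is at
most `4 κ h_i h_k`, and the averaging cancels `h_i h_k`. -/
theorem meanOsc_le_pairSemiSq {μ : Measure Plane} [IsFiniteMeasure μ] {u : Plane → ℝ}
    {T : ι → Set Plane} (hT : ∀ i, MeasurableSet (T i)) (hpos : ∀ i, μ (T i) ≠ 0) {κ : ℝ≥0∞}
    (hκ1 : 1 ≤ κ) {i k : ι} (hik : μ (T i) ≤ κ * μ (T k)) (hki : μ (T k) ≤ κ * μ (T i))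
    (hdiam : ∀ x ∈ T i, ∀ y ∈ T k, edist x y ≤ μ (T i) + μ (T k)) :
    meanOsc μ u T i k ≤ 4 * κ * pairSemiSq μ u (T i) (T k) := by
  set a := μ (T i)
  set b := μ (T k)
  have h1 : sqOsc u (μ.restrict (T i)) (μ.restrict (T k)) ≤
      (a + b) ^ 2 * pairSemiSq μ u (T i) (T k) := by
    have hab : (a + b) ^ 2 ≠ ∞ := by finiteness
    unfold sqOsc pairSemiSq
    rw [← lintegral_const_mul' _ _ hab]
    refine setLIntegral_mono' (hT i) fun x hx => ?_
    rw [← lintegral_const_mul' _ _ hab]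
    refine setLIntegral_mono' (hT k) fun y hy => ?_
    refine (sqDiff_le_diffQuot u x y).trans ?_
    gcongr
    exact hdiam x hx y hy
  have h2 : (a + b) ^ 2 ≤ 4 * κ * (a * b) := by
    calc (a + b) ^ 2 = a * a + 1 * (2 * (a * b)) + b * b := by ring
      _ ≤ a * (κ * b) + κ * (2 * (a * b)) + (κ * a) * b := by gcongr
      _ = 4 * κ * (a * b) := by ring
  rw [meanOsc_eq μ u hpos]
  calc a⁻¹ * (b⁻¹ * sqOsc u (μ.restrict (T i)) (μ.restrict (T k)))
      ≤ a⁻¹ * (b⁻¹ * (4 * κ * (a * b) * pairSemiSq μ u (T i) (T k))) := by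
        gcongr
        exact h1.trans (by gcongr)
    _ = (a * a⁻¹) * (b * b⁻¹) * (4 * κ * pairSemiSq μ u (T i) (T k)) := by ring
    _ = _ := by
        rw [ENNReal.mul_inv_cancel (hpos i) (by finiteness),
          ENNReal.mul_inv_cancel (hpos k) (by finiteness), one_mul, one_mul]

variable [Fintype ι]

/-- The oscillation over `ω` is split among the elements of the ball. Each has length at most `κ ^ m
h_j`, so a pair contributes at most `κ ^ (2 * m) h_j²` times its mean oscillation. One factor `h_j`
cancels against `μ ω ≥ h_j`, the other gives the scaling. -/
theorem inv_mul_lintegral_sq_le {μ : Measure Plane} [IsFiniteMeasure μ] {u : Plane → ℝ}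
    (hu : Measurable u) {T : ι → Set Plane} (hpos : ∀ i, μ (T i) ≠ 0) {κ : ℝ≥0∞}
    (hκ : ∀ i k, Meets T i k → μ (T k) ≤ κ * μ (T i)) {c : ℝ≥0∞} (hc0 : c ≠ 0) (hc1 : c ≠ ∞)
    {m : ℕ} {j : ι} {ω : Set Plane} (hjω : T j ⊆ ω) (hω : ω ⊆ ⋃ i ∈ ball (Meets T) j m, T i)
    (hpoinc : c * μ ω * ∫⁻ x in ω, ENNReal.ofReal (u x ^ 2) ∂μ ≤
      sqOsc u (μ.restrict ω) (μ.restrict ω)) :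
    (μ (T j))⁻¹ * ∫⁻ x in T j, ENNReal.ofReal (u x ^ 2) ∂μ ≤
      c⁻¹ * κ ^ (2 * m) *
        ∑ i ∈ ball (Meets T) j m, ∑ k ∈ ball (Meets T) j m, meanOsc μ u T i k := by
  set S := ∑ i ∈ ball (Meets T) j m, ∑ k ∈ ball (Meets T) j m, meanOsc μ u T i k
  set I := ∫⁻ x in T j, ENNReal.ofReal (u x ^ 2) ∂μ
  set h := μ (T j)
  have hh : h * h⁻¹ = 1 := ENNReal.mul_inv_cancel (hpos j) (by finiteness)
  have key : c * h * I ≤ κ ^ (2 * m) * h ^ 2 * S := by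
    calc c * h * I ≤ c * μ ω * ∫⁻ x in ω, ENNReal.ofReal (u x ^ 2) ∂μ := by
          exact mul_le_mul' (mul_le_mul' le_rfl (measure_mono hjω)) (lintegral_mono_set hjω)
      _ ≤ _ := hpoinc
      _ ≤ _ := sqOsc_restrict_le μ hu _ T hω
      _ ≤ ∑ i ∈ ball (Meets T) j m, ∑ k ∈ ball (Meets T) j m,
            κ ^ (2 * m) * h ^ 2 * meanOsc μ u T i k := by
          refine Finset.sum_le_sum fun i hi => Finset.sum_le_sum fun k hk => ?_
          rw [sqOsc_eq_meanOsc μ u hpos]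
          refine mul_le_mul' ?_ le_rfl
          calc μ (T i) * μ (T k) ≤ (κ ^ m * h) * (κ ^ m * h) :=
                mul_le_mul' (le_pow_mul_of_mem_ball hκ hi) (le_pow_mul_of_mem_ball hκ hk)
            _ = κ ^ (2 * m) * h ^ 2 := by ring
      _ = _ := by simp_rw [← Finset.mul_sum]; rfl
  calc h⁻¹ * I = (c⁻¹ * c) * (h * h⁻¹) * h⁻¹ * I := by
        rw [hh, ENNReal.inv_mul_cancel hc0 hc1, one_mul, one_mul]
    _ = c⁻¹ * h⁻¹ * h⁻¹ * (c * h * I) := by ring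
    _ ≤ c⁻¹ * h⁻¹ * h⁻¹ * (κ ^ (2 * m) * h ^ 2 * S) := by gcongr
    _ = c⁻¹ * κ ^ (2 * m) * S * (h * h⁻¹) * (h * h⁻¹) := by ring
    _ = _ := by rw [hh, mul_one, mul_one]

/-- The scaled `L²` norm is controlled by the seminorm on pairs of intersecting elements. -/
theorem scaledL2_le {μ : Measure Plane} [IsFiniteMeasure μ] {u : Plane → ℝ}
    (hu : Measurable u) {T : ι → Set Plane} (hT : ∀ i, MeasurableSet (T i))
    (hpos : ∀ i, μ (T i) ≠ 0) {κ : ℝ≥0∞} (hκ1 : 1 ≤ κ)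
    (hκ : ∀ i k, Meets T i k → μ (T k) ≤ κ * μ (T i))
    (hdiam : ∀ i k, Meets T i k → ∀ x ∈ T i, ∀ y ∈ T k, edist x y ≤ μ (T i) + μ (T k))
    {d : ℕ} (hd : ∀ i, (nbhd (Meets T) i).card ≤ d)
    {c : ℝ≥0∞} (hc0 : c ≠ 0) (hc1 : c ≠ ∞) {m : ℕ} {ω : ι → Set Plane}
    (hjω : ∀ j, T j ⊆ ω j) (hω : ∀ j, ω j ⊆ ⋃ i ∈ ball (Meets T) j m, T i)
    (hpoinc : ∀ j, c * μ (ω j) * ∫⁻ x in ω j, ENNReal.ofReal (u x ^ 2) ∂μ ≤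
      sqOsc u (μ.restrict (ω j)) (μ.restrict (ω j))) :
    scaledL2 μ u T ≤ c⁻¹ * κ ^ (2 * m) * (4 * d ^ m * (2 * d + 2) ^ m) * (4 * κ) *
      ∑ i, ∑ k ∈ nbhd (Meets T) i, pairSemiSq μ u (T i) (T k) := by
  have hprob : ∀ i, IsProbabilityMeasure (ProbabilityTheory.cond μ (T i)) := fun i =>
    ProbabilityTheory.cond_isProbabilityMeasure (hpos i)
  have hrefl : ∀ i, Meets T i i := fun i => by
    unfold Meets
    rw [inter_self]
    exact nonempty_of_measure_ne_zero (hpos i)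
  calc scaledL2 μ u T ≤ ∑ j, c⁻¹ * κ ^ (2 * m) *
        ∑ i ∈ ball (Meets T) j m, ∑ k ∈ ball (Meets T) j m, meanOsc μ u T i k :=
        Finset.sum_le_sum fun j _ =>
          inv_mul_lintegral_sq_le hu hpos hκ hc0 hc1 (hjω j) (hω j) (hpoinc j)
    _ ≤ c⁻¹ * κ ^ (2 * m) * (4 * d ^ m * (2 * d + 2) ^ m *
          ∑ j, ∑ i ∈ nbhd (Meets T) j, meanOsc μ u T j i) := by
        rw [← Finset.mul_sum]
        have hsymm : ∀ i k, meanOsc μ u T i k = meanOsc μ u T k i := fun i k =>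
          sqOsc_comm hu _ _
        have htri : ∀ i j k, meanOsc μ u T i k ≤ 2 * meanOsc μ u T i j + 2 * meanOsc μ u T j k :=
          fun i j k => sqOsc_triangle hu _ _ _
        exact mul_le_mul' le_rfl
          (sum_ball_ball_quasimetric_le (fun i k h => h.symm) hrefl hd hsymm htri m)
    _ ≤ c⁻¹ * κ ^ (2 * m) * (4 * d ^ m * (2 * d + 2) ^ m *
          ∑ j, ∑ i ∈ nbhd (Meets T) j, 4 * κ * pairSemiSq μ u (T j) (T i)) := by
        refine mul_le_mul' le_rfl (mul_le_mul' le_rfl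
          (Finset.sum_le_sum fun j _ => Finset.sum_le_sum fun i hi => ?_))
        rw [mem_nbhd] at hi
        exact meanOsc_le_pairSemiSq hT hpos hκ1 (hκ _ _ hi.symm) (hκ _ _ hi) (hdiam _ _ hi)
    _ = _ := by
        simp_rw [← Finset.mul_sum]
        ring

end Comparison

/-! ### Bi-Lipschitz bounds for piecewise `C²` parametrizations -/

section Parametrization

set_option linter.unusedSectionVars false

open Filter Topology

variable {E : Type*} [NormedAddCommGroup E] [NormedSpace ℝ E]

/-- The strict derivative of `γ` at `t` along the set `S`. -/
def StrictDerivOn (γ : ℝ → E) (S : Set ℝ) (t : ℝ) (v : E) : Prop :=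
  ∀ ε > 0, ∃ δ > 0, ∀ s ∈ S ∩ Icc (t - δ) (t + δ), ∀ s' ∈ S ∩ Icc (t - δ) (t + δ),
    ‖γ s - γ s' - (s - s') • v‖ ≤ ε * |s - s'|

theorem StrictDerivOn.hasDerivWithinAt {γ : ℝ → E} {S : Set ℝ} {t : ℝ} {v : E}
    (h : StrictDerivOn γ S t v) (ht : t ∈ S) : HasDerivWithinAt γ v S t := by
  rw [hasDerivWithinAt_iff_isLittleO, Asymptotics.isLittleO_iff]
  intro ε hε
  obtain ⟨δ, hδ, H⟩ := h ε hε
  have h1 : ∀ᶠ s in 𝓝[S] t, s ∈ Icc (t - δ) (t + δ) :=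
    mem_nhdsWithin_of_mem_nhds (Icc_mem_nhds (by linarith) (by linarith))
  filter_upwards [h1, self_mem_nhdsWithin] with s hs hsS
  exact H s ⟨hsS, hs⟩ t ⟨ht, by constructor <;> linarith⟩

/-- Mean value inequality for `γ x - x • v`, whose derivative is small near `t` because `γ'` is
continuous. -/
theorem strictDerivOn_of_contDiffOn {γ : ℝ → E} {c d t : ℝ} (hcd : c < d)
    (h : ContDiffOn ℝ 2 γ (Icc c d)) (ht : t ∈ Icc c d) :
    StrictDerivOn γ (Icc c d) t (derivWithin γ (Icc c d) t) := by
  intro ε hε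
  have hcont : ContinuousOn (derivWithin γ (Icc c d)) (Icc c d) :=
    h.continuousOn_derivWithin (uniqueDiffOn_Icc hcd) (by norm_num)
  have hdiff : DifferentiableOn ℝ γ (Icc c d) := h.differentiableOn (by norm_num)
  obtain ⟨δ, hδ, H⟩ := Metric.continuousWithinAt_iff.1 (hcont t ht) ε hε
  refine ⟨δ / 2, by positivity, fun s hs s' hs' => ?_⟩
  set v := derivWithin γ (Icc c d) t
  have hconv : Convex ℝ (Icc c d ∩ Icc (t - δ / 2) (t + δ / 2)) :=
    (convex_Icc _ _).inter (convex_Icc _ _)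
  have hd : ∀ x ∈ Icc c d ∩ Icc (t - δ / 2) (t + δ / 2),
      HasDerivWithinAt (fun x => γ x - x • v) (derivWithin γ (Icc c d) x - (1 : ℝ) • v)
        (Icc c d ∩ Icc (t - δ / 2) (t + δ / 2)) x := fun x hx =>
    ((hdiff x hx.1).hasDerivWithinAt.mono inter_subset_left).sub
      ((hasDerivWithinAt_id x _).smul_const v)
  have hb : ∀ x ∈ Icc c d ∩ Icc (t - δ / 2) (t + δ / 2),
      ‖derivWithin γ (Icc c d) x - (1 : ℝ) • v‖ ≤ ε := fun x hx => by
    rw [one_smul, ← dist_eq_norm]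
    refine (H hx.1 ?_).le
    rw [Real.dist_eq, abs_lt]
    constructor <;> linarith [hx.2.1, hx.2.2]
  have := hconv.norm_image_sub_le_of_norm_hasDerivWithin_le hd hb hs' hs
  rw [Real.norm_eq_abs] at this
  refine le_of_eq_of_le ?_ this
  congr 1
  rw [sub_smul]; abel

theorem StrictDerivOn.of_inter {γ : ℝ → E} {S S' : Set ℝ} {t r : ℝ} {v : E}
    (h : StrictDerivOn γ S t v) (hr : 0 < r) (hS : S' ∩ Icc (t - r) (t + r) ⊆ S) :
    StrictDerivOn γ S' t v := by
  intro ε hε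
  obtain ⟨δ, hδ, H⟩ := h ε hε
  have key : S' ∩ Icc (t - min δ r) (t + min δ r) ⊆ S ∩ Icc (t - δ) (t + δ) := by
    rintro s ⟨hs, h1, h2⟩
    have := min_le_left δ r
    have := min_le_right δ r
    exact ⟨hS ⟨hs, by linarith, by linarith⟩, by linarith, by linarith⟩
  exact ⟨min δ r, lt_min hδ hr, fun s hs s' hs' => H s (key hs) s' (key hs')⟩

/-- Otherwise `f i ≤ t` would propagate from the first to the last index. This serves both the
breakpoints of `γ` and the knots of a mesh. -/
theorem exists_castSucc_le_lt_succ {k : ℕ} (f : Fin (k + 1) → ℝ) {t : ℝ} (h0 : f 0 ≤ t)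
    (h1 : t < f (Fin.last k)) : ∃ i : Fin k, f i.castSucc ≤ t ∧ t < f i.succ := by
  by_contra! H
  exact absurd h1 (not_lt.2 (Fin.induction (motive := fun i => f i ≤ t) h0
    (fun i hi => H i hi) (Fin.last k)))

theorem exists_castSucc_lt_le_succ {k : ℕ} (f : Fin (k + 1) → ℝ) {t : ℝ} (h0 : f 0 < t)
    (h1 : t ≤ f (Fin.last k)) : ∃ i : Fin k, f i.castSucc < t ∧ t ≤ f i.succ := by
  by_contra! H
  exact absurd h1 (not_le.2 (Fin.induction (motive := fun i => f i < t) h0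
    (fun i hi => H i hi) (Fin.last k)))

/-- Even at a breakpoint, a right neighbourhood of `t` lies in a single `C²` piece, the one that
ends after `t`. -/
theorem PiecewiseC2.strictDerivOn_right {γ : ℝ → Plane} {a b t : ℝ} (h : PiecewiseC2 γ a b)
    (ht : t ∈ Ico a b) : StrictDerivOn γ (Ici t) t (rightDeriv γ t) := by
  obtain ⟨k, f, hf, h0, h1, H⟩ := h
  obtain ⟨i, hi, hi'⟩ := exists_castSucc_le_lt_succ f (h0 ▸ ht.1) (h1 ▸ ht.2)
  have hs := (strictDerivOn_of_contDiffOn (hf i.castSucc_lt_succ) (H i) ⟨hi, hi'.le⟩).of_inter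
    (S' := Ici t) (sub_pos.2 hi') fun s hs => ⟨hi.trans hs.1, by linarith [hs.2.2]⟩
  rwa [rightDeriv, (hs.hasDerivWithinAt self_mem_Ici).derivWithin (uniqueDiffWithinAt_Ici t)]

theorem PiecewiseC2.strictDerivOn_left {γ : ℝ → Plane} {a b t : ℝ} (h : PiecewiseC2 γ a b)
    (ht : t ∈ Ioc a b) : StrictDerivOn γ (Iic t) t (leftDeriv γ t) := by
  obtain ⟨k, f, hf, h0, h1, H⟩ := h
  obtain ⟨i, hi, hi'⟩ := exists_castSucc_lt_le_succ f (h0 ▸ ht.1) (h1 ▸ ht.2)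
  have hs := (strictDerivOn_of_contDiffOn (hf i.castSucc_lt_succ) (H i) ⟨hi.le, hi'⟩).of_inter
    (S' := Iic t) (sub_pos.2 hi) fun s hs => ⟨by linarith [hs.2.1], le_trans hs.1 hi'⟩
  rwa [leftDeriv, (hs.hasDerivWithinAt self_mem_Iic).derivWithin (uniqueDiffWithinAt_Iic t)]

/-- `γ` is bi-Lipschitz on a neighbourhood of `t` in `S`. -/
def LocallyBilipschitz (γ : ℝ → E) (S : Set ℝ) (t : ℝ) : Prop :=
  ∃ δ > 0, ∃ C, ∀ s ∈ S ∩ Icc (t - δ) (t + δ), ∀ s' ∈ S ∩ Icc (t - δ) (t + δ),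
    |s - s'| ≤ C * ‖γ s - γ s'‖ ∧ ‖γ s - γ s'‖ ≤ C * |s - s'|

theorem LocallyBilipschitz.of_inter {γ : ℝ → E} {S S' : Set ℝ} {t : ℝ}
    (h : LocallyBilipschitz γ S t) (hS : S' ⊆ S) : LocallyBilipschitz γ S' t := by
  obtain ⟨δ, hδ, C, H⟩ := h
  exact ⟨δ, hδ, C, fun s hs s' hs' => H s ⟨hS hs.1, hs.2⟩ s' ⟨hS hs'.1, hs'.2⟩⟩

/-- Here `z` is the linear model of an increment `x`, and an error of half the lower bound of `z` is
harmless. -/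
theorem bilipschitz_of_norm_sub_le {x z : E} {c B r : ℝ} (hc : 0 < c) (hB : 0 ≤ B) (hr : 0 ≤ r)
    (hlow : c * r ≤ ‖z‖) (hupp : ‖z‖ ≤ B * r) (hxz : ‖x - z‖ ≤ c / 2 * r) :
    r ≤ (2 / c + (B + c)) * ‖x‖ ∧ ‖x‖ ≤ (2 / c + (B + c)) * r := by
  have h1 : ‖z‖ ≤ ‖x‖ + ‖x - z‖ := by
    have := norm_sub_norm_le z x
    rw [norm_sub_rev] at this
    linarith
  have h2 : ‖x‖ ≤ ‖z‖ + ‖x - z‖ := by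
    have := norm_sub_norm_le x z
    linarith
  have h3 : c / 2 * r ≤ ‖x‖ := by linarith
  constructor
  · calc r = 2 / c * (c / 2 * r) := by field_simp
      _ ≤ 2 / c * ‖x‖ := by gcongr
      _ ≤ _ := by
          have := mul_nonneg (add_nonneg hB hc.le) (norm_nonneg x)
          linarith
  · have : 0 ≤ 2 / c * r := by positivity
    nlinarith [mul_nonneg hc.le hr]

theorem StrictDerivOn.locallyBilipschitz {γ : ℝ → E} {S : Set ℝ} {t : ℝ} {v : E}
    (h : StrictDerivOn γ S t v) (hv : v ≠ 0) : LocallyBilipschitz γ S t := by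
  have hv' := norm_pos_iff.2 hv
  obtain ⟨δ, hδ, H⟩ := h (‖v‖ / 2) (by positivity)
  refine ⟨δ, hδ, _, fun s hs s' hs' =>
    bilipschitz_of_norm_sub_le hv' hv'.le (abs_nonneg (s - s')) ?_ ?_ (H s hs s' hs')⟩
  all_goals rw [norm_smul, Real.norm_eq_abs, mul_comm]

/-- Two vectors that do not point in opposite directions. -/
theorem exists_pos_le_norm_smul_add_smul {v w : E} (hv : v ≠ 0) (hw : w ≠ 0)
    (hvw : ∀ c : ℝ, 0 < c → w + c • v ≠ 0) :
    ∃ c > 0, ∀ α β : ℝ, 0 ≤ α → 0 ≤ β → c * (α + β) ≤ ‖α • v + β • w‖ := by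
  -- The constant is the distance from the origin to the segment from `v` to `w`; homogeneity
  -- extends the bound to all nonnegative `α` and `β`.
  obtain ⟨x, hx, hmin⟩ := isCompact_Icc.exists_isMinOn (nonempty_Icc.2 (zero_le_one (α := ℝ)))
    (f := fun x : ℝ => ‖(1 - x) • v + x • w‖) (by fun_prop)
  refine ⟨‖(1 - x) • v + x • w‖, norm_pos_iff.2 fun h0 => ?_, fun α β hα hβ => ?_⟩
  · rcases eq_or_lt_of_le hx.1 with h | h
    · subst h; simp [hv] at h0
    · rcases eq_or_lt_of_le hx.2 with h' | h'
      · subst h'; simp [hw] at h0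
      · refine hvw ((1 - x) / x) (div_pos (by linarith) h) ?_
        have := congrArg (fun z => x⁻¹ • z) h0
        simp only [smul_add, smul_smul, smul_zero, inv_mul_cancel₀ h.ne', one_smul] at this
        rw [div_eq_inv_mul, add_comm]
        exact this
  · rcases (add_nonneg hα hβ).eq_or_lt with h | h
    · rw [← h]; simp
    · have hm := hmin (show β / (α + β) ∈ Icc (0 : ℝ) 1 from
        ⟨by positivity, (div_le_one h).2 (by linarith)⟩)
      have e : α • v + β • w = (α + β) • ((1 - β / (α + β)) • v + (β / (α + β)) • w) := by
        rw [smul_add, smul_smul, smul_smul]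
        congr 2 <;> field_simp
        ring
      rw [e, norm_smul, Real.norm_of_nonneg h.le, mul_comm]
      exact mul_le_mul_of_nonneg_left hm h.le

/-- An increment over `[s', s]` is modelled by `α • v + β • w`, where `α` and `β` are the lengths of
the parts of `[s', s]` to the right and to the left of `t`. As `v` and `w` are not opposite, the
model has norm at least `c (α + β)`. -/
theorem locallyBilipschitz_of_left_right {γ : ℝ → E} {t : ℝ} {v w : E}
    (hr : StrictDerivOn γ (Ici t) t v) (hl : StrictDerivOn γ (Iic t) t w) (hv : v ≠ 0)
    (hw : w ≠ 0) (hvw : ∀ c : ℝ, 0 < c → w + c • v ≠ 0) : LocallyBilipschitz γ univ t := by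
  obtain ⟨c, hc, hcvw⟩ := exists_pos_le_norm_smul_add_smul hv hw hvw
  obtain ⟨δ₁, hδ₁, H₁⟩ := hr (c / 2) (by positivity)
  obtain ⟨δ₂, hδ₂, H₂⟩ := hl (c / 2) (by positivity)
  have hm1 := min_le_left δ₁ δ₂
  have hm2 := min_le_right δ₁ δ₂
  have main : ∀ s ∈ Icc (t - min δ₁ δ₂) (t + min δ₁ δ₂), ∀ s' ∈ Icc (t - min δ₁ δ₂)
      (t + min δ₁ δ₂), s' ≤ s → ∃ α β : ℝ, 0 ≤ α ∧ 0 ≤ β ∧ α + β = s - s' ∧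
      ‖γ s - γ s' - (α • v + β • w)‖ ≤ c / 2 * (s - s') := by
    rintro s ⟨hs1, hs2⟩ s' ⟨hs1', hs2'⟩ hss
    rcases le_total t s' with h | h
    · refine ⟨s - s', 0, by linarith, le_rfl, by ring, ?_⟩
      have := H₁ s ⟨h.trans hss, by linarith, by linarith⟩ s' ⟨h, by linarith, by linarith⟩
      rwa [abs_of_nonneg (by linarith), ← add_zero ((s - s') • v), ← zero_smul ℝ w] at this
    rcases le_total s t with h' | h'
    · refine ⟨0, s - s', le_rfl, by linarith, by ring, ?_⟩
      have := H₂ s ⟨h', by linarith, by linarith⟩ s' ⟨h, by linarith, by linarith⟩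
      rwa [abs_of_nonneg (by linarith), ← zero_add ((s - s') • w), ← zero_smul ℝ v] at this
    · refine ⟨s - t, t - s', by linarith, by linarith, by ring, ?_⟩
      have e1 := H₁ s ⟨h', by linarith, by linarith⟩ t ⟨self_mem_Ici, by linarith, by linarith⟩
      have e2 := H₂ t ⟨self_mem_Iic, by linarith, by linarith⟩ s' ⟨h, by linarith, by linarith⟩
      rw [abs_of_nonneg (by linarith)] at e1 e2
      have e : γ s - γ s' - ((s - t) • v + (t - s') • w) =
          (γ s - γ t - (s - t) • v) + (γ t - γ s' - (t - s') • w) := by abel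
      rw [e]
      exact (norm_add_le _ _).trans (by linarith)
  refine ⟨min δ₁ δ₂, lt_min hδ₁ hδ₂, 2 / c + ((‖v‖ + ‖w‖) + c), ?_⟩
  have ordered : ∀ s ∈ Icc (t - min δ₁ δ₂) (t + min δ₁ δ₂), ∀ s' ∈ Icc (t - min δ₁ δ₂)
      (t + min δ₁ δ₂), s' ≤ s → |s - s'| ≤ (2 / c + ((‖v‖ + ‖w‖) + c)) * ‖γ s - γ s'‖ ∧
        ‖γ s - γ s'‖ ≤ (2 / c + ((‖v‖ + ‖w‖) + c)) * |s - s'| := by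
    intro s hs s' hs' hss
    obtain ⟨α, β, hα, hβ, hαβ, hle⟩ := main s hs s' hs' hss
    rw [abs_of_nonneg (by linarith)]
    refine bilipschitz_of_norm_sub_le hc (by positivity) (by linarith) ?_ ?_ hle
    · rw [← hαβ]; exact hcvw α β hα hβ
    · refine (norm_add_le _ _).trans ?_
      rw [norm_smul, norm_smul, Real.norm_of_nonneg hα, Real.norm_of_nonneg hβ, ← hαβ]
      nlinarith [mul_nonneg hα (norm_nonneg w), mul_nonneg hβ (norm_nonneg v)]
  rintro s ⟨-, hs⟩ s' ⟨-, hs'⟩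
  rcases le_total s' s with h | h
  · exact ordered s hs s' hs' h
  · rw [abs_sub_comm, norm_sub_rev]
    exact ordered s' hs' s hs h

/-- A local bound on a compact set is a global one. -/
theorem exists_forall_le_mul_of_local {X : Type*} [TopologicalSpace X] {K : Set X}
    (hK : IsCompact K) {f g : X → ℝ} (hg : ∀ p, 0 ≤ g p)
    (hloc : ∀ p ∈ K, ∃ C, ∀ᶠ q in 𝓝[K] p, f q ≤ C * g q) :
    ∃ C, ∀ q ∈ K, f q ≤ C * g q := by
  refine hK.induction_on (p := fun S => ∃ C, ∀ q ∈ S, f q ≤ C * g q) ⟨0, by simp⟩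
    (fun S S' hS ⟨C, h⟩ => ⟨C, fun q hq => h q (hS hq)⟩) ?_ fun p hp => ?_
  · rintro S S' ⟨C, h⟩ ⟨C', h'⟩
    refine ⟨max C C', fun q hq => ?_⟩
    rcases hq with hq | hq
    · exact (h q hq).trans (mul_le_mul_of_nonneg_right (le_max_left _ _) (hg q))
    · exact (h' q hq).trans (mul_le_mul_of_nonneg_right (le_max_right _ _) (hg q))
  · obtain ⟨C, h⟩ := hloc p hp
    exact ⟨{q | f q ≤ C * g q}, h, C, fun q hq => hq⟩

theorem eventually_le_mul_of_pos {X : Type*} [TopologicalSpace X] {K : Set X} {p : X}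
    {f g : X → ℝ} (hf : ContinuousWithinAt f K p) (hg : ContinuousWithinAt g K p) (h : 0 < g p) :
    ∃ C, ∀ᶠ q in 𝓝[K] p, f q ≤ C * g q := by
  refine ⟨(|f p| + 1) / (g p / 2), ?_⟩
  filter_upwards [hf.eventually (gt_mem_nhds (show f p < |f p| + 1 by linarith [le_abs_self (f p)])),
    hg.eventually (lt_mem_nhds (show g p / 2 < g p by linarith))] with q h1 h2
  calc f q ≤ (|f p| + 1) / (g p / 2) * (g p / 2) := by field_simp; linarith
    _ ≤ _ := by gcongr

/-- A Lipschitz parametrization whose inverse is Lipschitz for the distance of parameters, where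
the end points may be identified. -/
structure ChordArcParam (γ : ℝ → Plane) (a b : ℝ) (Γ : Set Plane) (C : ℝ) : Prop where
  lt : a < b
  image_eq : γ '' Icc a b = Γ
  le_mul : ∀ s ∈ Icc a b, ∀ t ∈ Icc a b, ‖γ s - γ t‖ ≤ C * |s - t|
  le_or : ∀ s ∈ Icc a b, ∀ t ∈ Icc a b, |s - t| ≤ C * ‖γ s - γ t‖ ∨
    (γ a = γ b ∧ (b - a) - |s - t| ≤ C * ‖γ s - γ t‖)

theorem eventually_of_locallyBilipschitz {γ : ℝ → E} {a b t : ℝ}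
    (h : LocallyBilipschitz γ (Icc a b) t) :
    ∃ C, ∀ᶠ q : ℝ × ℝ in 𝓝[Icc a b ×ˢ Icc a b] (t, t),
      |q.1 - q.2| ≤ C * ‖γ q.1 - γ q.2‖ ∧ ‖γ q.1 - γ q.2‖ ≤ C * |q.1 - q.2| := by
  obtain ⟨δ, hδ, C, H⟩ := h
  refine ⟨C, ?_⟩
  have hm : Icc (t - δ) (t + δ) ∈ 𝓝 t := Icc_mem_nhds (by linarith) (by linarith)
  filter_upwards [self_mem_nhdsWithin, mem_nhdsWithin_of_mem_nhds (prod_mem_nhds hm hm)]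
    with q hq hq'
  exact H q.1 ⟨hq.1, hq'.1⟩ q.2 ⟨hq.2, hq'.2⟩

theorem exists_lipschitz_of_local {γ : ℝ → E} {a b : ℝ} (hγ : ContinuousOn γ (Icc a b))
    (hloc : ∀ t ∈ Icc a b, LocallyBilipschitz γ (Icc a b) t) :
    ∃ C, ∀ q ∈ Icc a b ×ˢ Icc a b, ‖γ q.1 - γ q.2‖ ≤ C * |q.1 - q.2| := by
  have hcont : ContinuousOn (fun q : ℝ × ℝ => ‖γ q.1 - γ q.2‖) (Icc a b ×ˢ Icc a b) :=
    ((hγ.comp continuousOn_fst fun q hq => hq.1).sub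
      (hγ.comp continuousOn_snd fun q hq => hq.2)).norm
  refine exists_forall_le_mul_of_local (isCompact_Icc.prod isCompact_Icc)
    (fun q => abs_nonneg _) ?_
  rintro ⟨s, t⟩ hst
  rcases eq_or_ne s t with rfl | hne
  · obtain ⟨C, h⟩ := eventually_of_locallyBilipschitz (hloc s hst.1)
    exact ⟨C, h.mono fun q hq => hq.2⟩
  · exact eventually_le_mul_of_pos (hcont _ hst) (by fun_prop) (abs_pos.2 (sub_ne_zero.2 hne))

/-- By compactness of the parameter square, local bounds suffice: on the diagonal they are the
bi-Lipschitz bounds, off it the chord is positive by injectivity. -/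
theorem IsOpenParam.exists_chordArcParam {γ : ℝ → Plane} {a b : ℝ} {Γ : Set Plane}
    (h : IsOpenParam γ a b Γ) : ∃ C, ChordArcParam γ a b Γ C := by
  have hloc : ∀ t ∈ Icc a b, LocallyBilipschitz γ (Icc a b) t := by
    intro t ht
    rcases eq_or_lt_of_le ht.1 with rfl | h1
    · exact ((h.piecewiseC2.strictDerivOn_right ⟨le_rfl, h.lt⟩).locallyBilipschitz
        (h.rightDeriv_ne_zero _ ⟨le_rfl, h.lt⟩)).of_inter Icc_subset_Ici_self
    rcases eq_or_lt_of_le ht.2 with rfl | h2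
    · exact ((h.piecewiseC2.strictDerivOn_left ⟨h.lt, le_rfl⟩).locallyBilipschitz
        (h.leftDeriv_ne_zero _ ⟨h.lt, le_rfl⟩)).of_inter Icc_subset_Iic_self
    · exact (locallyBilipschitz_of_left_right (h.piecewiseC2.strictDerivOn_right ⟨ht.1, h2⟩)
        (h.piecewiseC2.strictDerivOn_left ⟨h1, ht.2⟩) (h.rightDeriv_ne_zero _ ⟨ht.1, h2⟩)
        (h.leftDeriv_ne_zero _ ⟨h1, ht.2⟩) (h.no_cusp t ⟨h1, h2⟩)).of_inter (subset_univ _)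
  have hcont : ContinuousOn (fun q : ℝ × ℝ => ‖γ q.1 - γ q.2‖) (Icc a b ×ˢ Icc a b) :=
    ((h.continuousOn.comp continuousOn_fst fun q hq => hq.1).sub
      (h.continuousOn.comp continuousOn_snd fun q hq => hq.2)).norm
  obtain ⟨C₁, h₁⟩ := exists_lipschitz_of_local h.continuousOn hloc
  obtain ⟨C₂, h₂⟩ : ∃ C, ∀ q ∈ Icc a b ×ˢ Icc a b, |q.1 - q.2| ≤ C * ‖γ q.1 - γ q.2‖ := by
    refine exists_forall_le_mul_of_local (isCompact_Icc.prod isCompact_Icc)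
      (fun q => norm_nonneg _) ?_
    rintro ⟨s, t⟩ hst
    rcases eq_or_ne s t with rfl | hne
    · obtain ⟨C, h⟩ := eventually_of_locallyBilipschitz (hloc s hst.1)
      exact ⟨C, h.mono fun q hq => hq.1⟩
    · exact eventually_le_mul_of_pos (by fun_prop) (hcont _ hst) (norm_pos_iff.2
        (sub_ne_zero.2 fun e => hne (h.bijOn.injOn hst.1 hst.2 e)))
  exact ⟨max C₁ C₂, h.lt, h.bijOn.image_eq,
    fun s hs t ht => (h₁ (s, t) ⟨hs, ht⟩).trans
      (mul_le_mul_of_nonneg_right (le_max_left _ _) (abs_nonneg _)),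
    fun s hs t ht => Or.inl ((h₂ (s, t) ⟨hs, ht⟩).trans
      (mul_le_mul_of_nonneg_right (le_max_right _ _) (norm_nonneg _)))⟩

theorem StrictDerivOn.translate {γ : ℝ → E} {S S' : Set ℝ} {t p : ℝ} {v : E}
    (h : StrictDerivOn γ S t v) (hγ : Function.Periodic γ p) (hS : ∀ s ∈ S', s - p ∈ S) :
    StrictDerivOn γ S' (t + p) v := by
  intro ε hε
  obtain ⟨δ, hδ, H⟩ := h ε hε
  refine ⟨δ, hδ, fun s hs s' hs' => ?_⟩
  have := H (s - p) ⟨hS s hs.1, by linarith [hs.2.1], by linarith [hs.2.2]⟩ (s' - p)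
    ⟨hS s' hs'.1, by linarith [hs'.2.1], by linarith [hs'.2.2]⟩
  rwa [hγ.sub_eq, hγ.sub_eq, sub_sub_sub_cancel_right] at this

/-- At the seam, periodicity carries the right derivative from `a` to `b` and the left derivative
from `b` to `a`. -/
theorem IsClosedParam.locallyBilipschitz {γ : ℝ → Plane} {a b : ℝ} {Γ : Set Plane}
    (h : IsClosedParam γ a b Γ) {t : ℝ} (ht : t ∈ Icc a b) : LocallyBilipschitz γ univ t := by
  have hlt := h.lt
  have hright : StrictDerivOn γ (Ici t) t (rightDeriv γ t) ∧ rightDeriv γ t ≠ 0 := by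
    rcases eq_or_lt_of_le ht.2 with rfl | h2
    · have e := (h.piecewiseC2.strictDerivOn_right (left_mem_Ico.2 hlt)).translate
        (S' := Ici t) h.periodic (fun s hs => by simp only [mem_Ici] at *; linarith)
      rw [add_sub_cancel] at e
      have e' := (e.hasDerivWithinAt self_mem_Ici).derivWithin (uniqueDiffWithinAt_Ici t)
      rw [rightDeriv, e']
      exact ⟨e, h.rightDeriv_ne_zero a (left_mem_Ico.2 hlt)⟩
    · exact ⟨h.piecewiseC2.strictDerivOn_right ⟨ht.1, h2⟩, h.rightDeriv_ne_zero t ⟨ht.1, h2⟩⟩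
  have hleft : StrictDerivOn γ (Iic t) t (leftDeriv γ t) ∧ leftDeriv γ t ≠ 0 := by
    rcases eq_or_lt_of_le ht.1 with rfl | h1
    · have e := (h.piecewiseC2.strictDerivOn_left (right_mem_Ioc.2 hlt)).translate
        (S' := Iic a) h.periodic.neg (fun s hs => by simp only [mem_Iic] at *; linarith)
      rw [neg_sub, add_sub_cancel] at e
      have e' := (e.hasDerivWithinAt self_mem_Iic).derivWithin (uniqueDiffWithinAt_Iic a)
      rw [leftDeriv, e']
      exact ⟨e, h.leftDeriv_ne_zero b (right_mem_Ioc.2 hlt)⟩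
    · exact ⟨h.piecewiseC2.strictDerivOn_left ⟨h1, ht.2⟩, h.leftDeriv_ne_zero t ⟨h1, ht.2⟩⟩
  exact locallyBilipschitz_of_left_right hright.1 hleft.1 hright.2 hleft.2 (h.no_cusp t ht)

theorem IsClosedParam.apply_left_eq {γ : ℝ → Plane} {a b : ℝ} {Γ : Set Plane}
    (h : IsClosedParam γ a b Γ) : γ a = γ b := by
  have := h.periodic a
  rwa [add_sub_cancel, eq_comm] at this

theorem IsClosedParam.eq_or_of_apply_eq {γ : ℝ → Plane} {a b : ℝ} {Γ : Set Plane}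
    (h : IsClosedParam γ a b Γ) {s t : ℝ} (hs : s ∈ Icc a b) (ht : t ∈ Icc a b)
    (hst : γ s = γ t) : s = t ∨ (s = a ∧ t = b) ∨ (s = b ∧ t = a) := by
  rcases eq_or_lt_of_le hs.2 with rfl | hs2 <;> rcases eq_or_lt_of_le ht.2 with rfl | ht2
  · exact Or.inl rfl
  · rw [← h.apply_left_eq] at hst
    exact Or.inr (Or.inr ⟨rfl, (h.bijOn.injOn (left_mem_Ico.2 h.lt) ⟨ht.1, ht2⟩ hst).symm⟩)
  · rw [← h.apply_left_eq] at hst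
    exact Or.inr (Or.inl ⟨h.bijOn.injOn ⟨hs.1, hs2⟩ (left_mem_Ico.2 h.lt) hst, rfl⟩)
  · exact Or.inl (h.bijOn.injOn ⟨hs.1, hs2⟩ ⟨ht.1, ht2⟩ hst)

theorem IsClosedParam.image_Icc {γ : ℝ → Plane} {a b : ℝ} {Γ : Set Plane}
    (h : IsClosedParam γ a b Γ) : γ '' Icc a b = Γ := by
  rw [← h.bijOn.image_eq, ← Ico_insert_right h.lt.le, image_insert_eq, ← h.apply_left_eq]
  exact insert_eq_of_mem (mem_image_of_mem _ (left_mem_Ico.2 h.lt))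

theorem IsClosedParam.exists_chordArcParam {γ : ℝ → Plane} {a b : ℝ} {Γ : Set Plane}
    (h : IsClosedParam γ a b Γ) : ∃ C, ChordArcParam γ a b Γ C := by
  have hlt := h.lt
  have hγ := h.continuous
  have hloc : ∀ t ∈ Icc a b, LocallyBilipschitz γ (Icc a b) t := fun t ht =>
    (h.locallyBilipschitz ht).of_inter (subset_univ _)
  obtain ⟨C₁, h₁⟩ := exists_lipschitz_of_local hγ.continuousOn hloc
  -- The minimum is the distance of parameters on the circle. The chord vanishes on the diagonal and
  -- at the corners `(a, b)` and `(b, a)`.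
  obtain ⟨C₂, h₂⟩ : ∃ C, ∀ q ∈ Icc a b ×ˢ Icc a b,
      min |q.1 - q.2| ((b - a) - |q.1 - q.2|) ≤ C * ‖γ q.1 - γ q.2‖ := by
    refine exists_forall_le_mul_of_local (isCompact_Icc.prod isCompact_Icc)
      (fun q => norm_nonneg _) ?_
    obtain ⟨δ, hδ, D, H⟩ := h.locallyBilipschitz (left_mem_Icc.2 hlt.le)
    have ha : Icc (a - δ) (a + δ) ∈ 𝓝 a := Icc_mem_nhds (by linarith) (by linarith)
    have hb : Icc (b - δ) (b + δ) ∈ 𝓝 b := Icc_mem_nhds (by linarith) (by linarith)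
    -- Shifting `t` back by one period moves it next to `a`, where the local bound applies.
    have hab : ∀ s ∈ Icc (a - δ) (a + δ), ∀ t ∈ Icc (b - δ) (b + δ),
        (b - a) - |s - t| ≤ D * ‖γ s - γ t‖ := by
      intro s hs t ht
      have := (H s ⟨mem_univ _, hs⟩ (t - (b - a))
        ⟨mem_univ _, by linarith [ht.1], by linarith [ht.2]⟩).1
      rw [h.periodic.sub_eq] at this
      refine le_trans ?_ this
      have h1 := neg_abs_le (s - t)
      have h2 := le_abs_self (s - (t - (b - a)))
      linarith
    rintro ⟨s, t⟩ hst
    by_cases he : γ s = γ t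
    · have hor : s = t ∨ (s = a ∧ t = b) ∨ (s = b ∧ t = a) :=
        h.eq_or_of_apply_eq hst.1 hst.2 he
      rcases hor with rfl | ⟨rfl, rfl⟩ | ⟨rfl, rfl⟩
      · obtain ⟨C, h⟩ := eventually_of_locallyBilipschitz (hloc s hst.1)
        exact ⟨C, h.mono fun q hq => (min_le_left _ _).trans hq.1⟩
      · refine ⟨D, ?_⟩
        filter_upwards [mem_nhdsWithin_of_mem_nhds (prod_mem_nhds ha hb)] with q hq
        exact (min_le_right _ _).trans (hab q.1 hq.1 q.2 hq.2)
      · refine ⟨D, ?_⟩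
        filter_upwards [mem_nhdsWithin_of_mem_nhds (prod_mem_nhds hb ha)] with q hq
        rw [abs_sub_comm, norm_sub_rev]
        exact (min_le_right _ _).trans (hab q.2 hq.2 q.1 hq.1)
    · exact eventually_le_mul_of_pos (by fun_prop) (by fun_prop)
        (norm_pos_iff.2 (sub_ne_zero.2 he))
  refine ⟨max C₁ C₂, h.lt, h.image_Icc, fun s hs t ht => (h₁ (s, t) ⟨hs, ht⟩).trans
      (mul_le_mul_of_nonneg_right (le_max_left _ _) (abs_nonneg _)), fun s hs t ht => ?_⟩
  have := (h₂ (s, t) ⟨hs, ht⟩).trans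
    (mul_le_mul_of_nonneg_right (le_max_right C₁ C₂) (norm_nonneg _))
  rcases min_le_iff.1 this with h' | h'
  · exact Or.inl h'
  · exact Or.inr ⟨h.apply_left_eq, h'⟩

end Parametrization

/-! ### Geometry of chord-arc curves -/

/-- A connected set is at least as long as the distance of any two of its points. -/
theorem IsPreconnected.edist_le_hausdorffMeasure {X : Type*} [MetricSpace X] [MeasurableSpace X]
    [BorelSpace X] {S : Set X} (hS : IsPreconnected S) {x y : X} (hx : x ∈ S) (hy : y ∈ S) :
    edist x y ≤ μH[1] S := by
  -- The distance to `x` does not increase length, and its image of `S` contains `[0, dist x y]`.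
  have hlip : LipschitzWith 1 (fun z => dist x z) := LipschitzWith.dist_right x
  have himg : Icc 0 (dist x y) ⊆ (fun z => dist x z) '' S :=
    (hS.image _ hlip.continuous.continuousOn).Icc_subset ⟨x, hx, dist_self x⟩ ⟨y, hy, rfl⟩
  have hle := (hlip.lipschitzOnWith (s := S)).hausdorffMeasure_image_le zero_le_one
  rw [hausdorffMeasure_real] at hle
  calc edist x y = volume (Icc 0 (dist x y)) := by
        rw [Real.volume_Icc, sub_zero, edist_dist]
    _ ≤ volume ((fun z => dist x z) '' S) := measure_mono himg
    _ ≤ _ := by simpa using hle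

namespace ChordArcParam

variable {γ : ℝ → Plane} {a b C : ℝ} {Γ : Set Plane}

theorem lipschitzOnWith (h : ChordArcParam γ a b Γ C) :
    LipschitzOnWith C.toNNReal γ (Icc a b) := by
  refine LipschitzOnWith.of_dist_le_mul fun s hs t ht => ?_
  rw [dist_eq_norm, Real.dist_eq]
  refine (h.le_mul s hs t ht).trans ?_
  gcongr
  exact Real.le_coe_toNNReal C

theorem continuousOn (h : ChordArcParam γ a b Γ C) : ContinuousOn γ (Icc a b) :=
  h.lipschitzOnWith.continuousOn

theorem nonneg (h : ChordArcParam γ a b Γ C) : 0 ≤ C := by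
  have h1 := h.le_mul a (left_mem_Icc.2 h.lt.le) b (right_mem_Icc.2 h.lt.le)
  have h2 : 0 < |a - b| := abs_pos.2 (sub_ne_zero.2 h.lt.ne)
  by_contra hC
  nlinarith [norm_nonneg (γ a - γ b), mul_neg_of_neg_of_pos (not_le.1 hC) h2]

theorem measure_image_le (h : ChordArcParam γ a b Γ C) {S : Set ℝ} (hS : S ⊆ Icc a b) :
    μH[1] (γ '' S) ≤ ENNReal.ofReal C * volume S := by
  have := (h.lipschitzOnWith.mono hS).hausdorffMeasure_image_le zero_le_one
  rw [hausdorffMeasure_real, ENNReal.rpow_one] at this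
  exact this

theorem measure_lt_top (h : ChordArcParam γ a b Γ C) : μH[1] Γ < ∞ := by
  rw [← h.image_eq]
  refine (h.measure_image_le subset_rfl).trans_lt ?_
  rw [Real.volume_Icc]
  finiteness

/-- Parameters of points in the ball lie within `C ρ` of the parameter of its centre or, across the
seam, within `C ρ` of an end point: total length at most `4 C ρ`. -/
theorem measure_closedBall_le (h : ChordArcParam γ a b Γ C) {x : Plane} (hx : x ∈ Γ) {ρ : ℝ≥0∞}
    (hρ : ρ ≠ 0) :
    μH[1] (Γ ∩ {y | edist x y ≤ ρ}) ≤ (ENNReal.ofReal C * ENNReal.ofReal (4 * C) + 1) * ρ := by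
  -- The summand `1` in the constant keeps the factor nonzero, so that its product with `∞` is `∞`.
  rcases eq_or_ne ρ ∞ with rfl | hρt
  · rw [ENNReal.mul_top (by simp)]
    exact le_top
  have hC := h.nonneg
  rw [← h.image_eq] at hx
  obtain ⟨t, ht, rfl⟩ := hx
  set r := ρ.toReal
  have hr : 0 ≤ r := ENNReal.toReal_nonneg
  have hρr : ρ = ENNReal.ofReal r := (ENNReal.ofReal_toReal hρt).symm
  set S := Icc a b ∩ (Icc (t - C * r) (t + C * r) ∪ (Icc a (a + C * r) ∪ Icc (b - C * r) b))
  have hsub : Γ ∩ {y | edist (γ t) y ≤ ρ} ⊆ γ '' S := by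
    rintro y ⟨hy, hyρ⟩
    rw [← h.image_eq] at hy
    obtain ⟨s, hs, rfl⟩ := hy
    refine ⟨s, ⟨hs, ?_⟩, rfl⟩
    have hd : ‖γ t - γ s‖ ≤ r := by
      rw [mem_ofPred_eq, hρr, edist_dist, ENNReal.ofReal_le_ofReal_iff hr, dist_eq_norm] at hyρ
      exact hyρ
    have hCd := mul_le_mul_of_nonneg_left hd hC
    rcases h.le_or t ht s hs with h1 | ⟨-, h1⟩
    · have := abs_le.1 (h1.trans hCd)
      exact Or.inl ⟨by linarith, by linarith⟩
    · right
      rcases abs_cases (t - s) with ⟨e, -⟩ | ⟨e, -⟩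
      · exact Or.inl ⟨hs.1, by linarith [ht.2]⟩
      · exact Or.inr ⟨by linarith [ht.1], hs.2⟩
  calc μH[1] (Γ ∩ {y | edist (γ t) y ≤ ρ}) ≤ μH[1] (γ '' S) := measure_mono hsub
    _ ≤ ENNReal.ofReal C * volume S := h.measure_image_le inter_subset_left
    _ ≤ ENNReal.ofReal C * (ENNReal.ofReal (4 * C) * ρ) := by
        gcongr
        have hCr : 0 ≤ C * r := mul_nonneg hC hr
        calc volume S ≤ volume (Icc (t - C * r) (t + C * r)) +
              (volume (Icc a (a + C * r)) + volume (Icc (b - C * r) b)) :=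
              (measure_mono inter_subset_right).trans ((measure_union_le _ _).trans
                (add_le_add_right (measure_union_le _ _) _))
          _ = ENNReal.ofReal (4 * C) * ρ := by
              rw [Real.volume_Icc, Real.volume_Icc, Real.volume_Icc, hρr,
                ← ENNReal.ofReal_mul (by positivity),
                ← ENNReal.ofReal_add (by linarith) (by linarith),
                ← ENNReal.ofReal_add (by linarith) (by linarith)]
              congr 1
              ring
    _ ≤ _ := by
        rw [← mul_assoc]
        gcongr
        exact le_self_add

/-- Take the direct arc, or the complementary one through the seam, according to which alternative
of `le_or` holds. One factor `C` bounds parameter length by the chord, the other bounds arclength by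
parameter length. -/
theorem exists_preconnected_aux (h : ChordArcParam γ a b Γ C) {s t : ℝ} (hs : s ∈ Icc a b)
    (ht : t ∈ Icc a b) (hst : s ≤ t) :
    ∃ A ⊆ Γ, IsPreconnected A ∧ γ s ∈ A ∧ γ t ∈ A ∧
      μH[1] A ≤ ENNReal.ofReal C * ENNReal.ofReal C * edist (γ s) (γ t) := by
  have hC := h.nonneg
  have hd : ENNReal.ofReal C * ENNReal.ofReal C * edist (γ s) (γ t) =
      ENNReal.ofReal C * ENNReal.ofReal (C * ‖γ s - γ t‖) := by
    rw [ENNReal.ofReal_mul hC, edist_dist, dist_eq_norm, mul_assoc]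
  rw [hd]
  have habs : |s - t| = t - s := by rw [abs_sub_comm, abs_of_nonneg (by linarith)]
  rcases h.le_or s hs t ht with h1 | ⟨hab, h1⟩
  · have hsub : Icc s t ⊆ Icc a b := Icc_subset_Icc hs.1 ht.2
    refine ⟨γ '' Icc s t, h.image_eq ▸ image_mono hsub,
      isPreconnected_Icc.image _ (h.continuousOn.mono hsub),
      mem_image_of_mem _ (left_mem_Icc.2 hst), mem_image_of_mem _ (right_mem_Icc.2 hst), ?_⟩
    refine (h.measure_image_le hsub).trans ?_
    rw [Real.volume_Icc, ← habs]
    gcongr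
  · have h1' : Icc a s ⊆ Icc a b := Icc_subset_Icc le_rfl hs.2
    have h2' : Icc t b ⊆ Icc a b := Icc_subset_Icc ht.1 le_rfl
    refine ⟨γ '' Icc a s ∪ γ '' Icc t b, ?_, ?_, Or.inl (mem_image_of_mem _ (right_mem_Icc.2 hs.1)),
      Or.inr (mem_image_of_mem _ (left_mem_Icc.2 ht.2)), ?_⟩
    · rw [← image_union, ← h.image_eq]
      exact image_mono (union_subset h1' h2')
    · exact (isPreconnected_Icc.image _ (h.continuousOn.mono h1')).union (γ a)
        (mem_image_of_mem _ (left_mem_Icc.2 hs.1))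
        (hab ▸ mem_image_of_mem _ (right_mem_Icc.2 ht.2))
        (isPreconnected_Icc.image _ (h.continuousOn.mono h2'))
    · calc _ ≤ ENNReal.ofReal C * volume (Icc a s) + ENNReal.ofReal C * volume (Icc t b) :=
            (measure_union_le _ _).trans
              (add_le_add (h.measure_image_le h1') (h.measure_image_le h2'))
        _ = ENNReal.ofReal C * ENNReal.ofReal ((b - a) - |s - t|) := by
            rw [← mul_add, Real.volume_Icc, Real.volume_Icc, ← ENNReal.ofReal_add
              (by linarith [hs.1]) (by linarith [ht.2]), habs]
            congr 2
            ring
        _ ≤ _ := by gcongr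

theorem exists_preconnected (h : ChordArcParam γ a b Γ C) {x y : Plane} (hx : x ∈ Γ)
    (hy : y ∈ Γ) : ∃ A ⊆ Γ, IsPreconnected A ∧ x ∈ A ∧ y ∈ A ∧
      μH[1] A ≤ ENNReal.ofReal C * ENNReal.ofReal C * edist x y := by
  rw [← h.image_eq] at hx hy
  obtain ⟨s, hs, rfl⟩ := hx
  obtain ⟨t, ht, rfl⟩ := hy
  rcases le_total s t with hst | hst
  · exact h.exists_preconnected_aux hs ht hst
  · obtain ⟨A, hA, hc, h1, h2, h3⟩ := h.exists_preconnected_aux ht hs hst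
    exact ⟨A, hA, hc, h2, h1, by rwa [edist_comm]⟩

theorem eq_or_of_apply_eq (h : ChordArcParam γ a b Γ C) {s t : ℝ} (hs : s ∈ Icc a b)
    (ht : t ∈ Icc a b) (hst : γ s = γ t) : s = t ∨ (s = a ∧ t = b) ∨ (s = b ∧ t = a) := by
  have := h.le_or s hs t ht
  rw [hst, sub_self, norm_zero, mul_zero] at this
  rcases this with h1 | ⟨-, h1⟩
  · exact Or.inl (sub_eq_zero.1 (abs_nonpos_iff.1 h1))
  · right
    rcases abs_cases (s - t) with ⟨e, -⟩ | ⟨e, -⟩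
    · exact Or.inr ⟨by linarith [hs.2, ht.1], by linarith [hs.2, ht.1]⟩
    · exact Or.inl ⟨by linarith [ht.2, hs.1], by linarith [ht.2, hs.1]⟩

theorem isClosed_image_Icc (h : ChordArcParam γ a b Γ C) {s t : ℝ} (hs : a ≤ s) (ht : t ≤ b) :
    IsClosed (γ '' Icc s t) :=
  (isCompact_Icc.image_of_continuousOn (h.continuousOn.mono (Icc_subset_Icc hs ht))).isClosed

/-- Two missing points separate a curve. -/
theorem not_mem_of_two_gaps (h : ChordArcParam γ a b Γ C) {A : Set Plane} (hA : IsPreconnected A)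
    (hAΓ : A ⊆ Γ) {τ σ s t : ℝ} (hτ : a ≤ τ) (hσ : σ ≤ b) (hτσ : τ ≤ σ) (hτA : γ τ ∉ A)
    (hσA : γ σ ∉ A) (hs : s ∈ Icc τ σ) (ht : t ∈ Icc a τ ∪ Icc σ b) (hsA : γ s ∈ A) :
    γ t ∉ A := by
  intro htA
  have hcl := h.isClosed_image_Icc hτ hσ
  have hcl' := (h.isClosed_image_Icc le_rfl (hτσ.trans hσ)).union
    (h.isClosed_image_Icc (hτ.trans hτσ) le_rfl)
  have hcov : A ⊆ γ '' Icc τ σ ∪ (γ '' Icc a τ ∪ γ '' Icc σ b) := by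
    intro x hx
    have := hAΓ hx
    rw [← h.image_eq] at this
    obtain ⟨r, hr, rfl⟩ := this
    rcases le_total r τ with h1 | h1
    · exact Or.inr (Or.inl (mem_image_of_mem _ ⟨hr.1, h1⟩))
    rcases le_total r σ with h2 | h2
    · exact Or.inl (mem_image_of_mem _ ⟨h1, h2⟩)
    · exact Or.inr (Or.inr (mem_image_of_mem _ ⟨h2, hr.2⟩))
  -- A connected `A` meeting both closed arcs would meet their intersection, which consists of the
  -- missing points `γ τ` and `γ σ` at most.
  obtain ⟨x, hxA, ⟨r, hr, rfl⟩, hx2⟩ := isPreconnected_closed_iff.1 hA _ _ hcl hcl' hcov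
    ⟨γ s, hsA, mem_image_of_mem _ hs⟩
    ⟨γ t, htA, by rw [← image_union]; exact mem_image_of_mem _ ht⟩
  rw [← image_union] at hx2
  obtain ⟨r', hr', he⟩ := hx2
  have hrI : r ∈ Icc a b := ⟨hτ.trans hr.1, hr.2.trans hσ⟩
  have hrI' : r' ∈ Icc a b := by
    rcases hr' with hr' | hr'
    · exact ⟨hr'.1, hr'.2.trans (hτσ.trans hσ)⟩
    · exact ⟨(hτ.trans hτσ).trans hr'.1, hr'.2⟩
  have hend : r = τ ∨ r = σ := by
    rcases h.eq_or_of_apply_eq hrI hrI' he.symm with e | ⟨e, -⟩ | ⟨e, -⟩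
    · subst e
      rcases hr' with hr' | hr'
      · exact Or.inl (le_antisymm hr'.2 hr.1)
      · exact Or.inr (le_antisymm hr.2 hr'.1)
    · exact Or.inl (le_antisymm (e ▸ hτ) hr.1)
    · exact Or.inr (le_antisymm hr.2 (e ▸ hσ))
  rcases hend with rfl | rfl
  · exact hτA hxA
  · exact hσA hxA

/-- One missing point separates an open curve. -/
theorem not_mem_of_gap (h : ChordArcParam γ a b Γ C) (hab : γ a ≠ γ b) {A : Set Plane}
    (hA : IsPreconnected A) (hAΓ : A ⊆ Γ) {σ s t : ℝ} (hσ : σ ∈ Icc a b) (hσA : γ σ ∉ A)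
    (hs : s ∈ Icc a σ) (ht : t ∈ Icc σ b) (hsA : γ s ∈ A) : γ t ∉ A := by
  intro htA
  have hcov : A ⊆ γ '' Icc a σ ∪ γ '' Icc σ b := by
    rw [← image_union, Icc_union_Icc_eq_Icc hσ.1 hσ.2, h.image_eq]
    exact hAΓ
  obtain ⟨x, hxA, ⟨r, hr, rfl⟩, ⟨r', hr', he⟩⟩ := isPreconnected_closed_iff.1 hA _ _
    (h.isClosed_image_Icc le_rfl hσ.2) (h.isClosed_image_Icc hσ.1 le_rfl) hcov
    ⟨γ s, hsA, mem_image_of_mem _ hs⟩ ⟨γ t, htA, mem_image_of_mem _ ht⟩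
  rcases h.eq_or_of_apply_eq ⟨hr.1, hr.2.trans hσ.2⟩ ⟨hσ.1.trans hr'.1, hr'.2⟩ he.symm with
    e | ⟨e, e'⟩ | ⟨e, e'⟩
  · rw [le_antisymm hr.2 (e ▸ hr'.1)] at hxA
    exact hσA hxA
  · rw [e, e'] at he
    exact hab he.symm
  · have := h.lt
    linarith [hr.2, hr'.1]

end ChordArcParam

/-! ### Geometry of meshes -/

namespace Mesh

variable {γ : ℝ → Plane} {a b C : ℝ} {Γ : Set Plane} (𝒯 : Mesh γ a b)

theorem knot_mem (i : Fin (𝒯.n + 1)) : 𝒯.knot i ∈ Icc a b := by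
  constructor
  · exact 𝒯.knot_zero.symm.le.trans (𝒯.strictMono.monotone (Fin.zero_le i))
  · exact (𝒯.strictMono.monotone (Fin.le_last i)).trans 𝒯.knot_last.le

theorem knot_lt_succ (j : Fin 𝒯.n) : 𝒯.knot j.castSucc < 𝒯.knot j.succ :=
  𝒯.strictMono j.castSucc_lt_succ

theorem knot_succ_le_castSucc {i k : Fin 𝒯.n} (h : i.val < k.val) :
    𝒯.knot i.succ ≤ 𝒯.knot k.castSucc :=
  𝒯.strictMono.monotone (Fin.le_def.2 (by simpa using h))

theorem Icc_knot_subset (j : Fin 𝒯.n) : Icc (𝒯.knot j.castSucc) (𝒯.knot j.succ) ⊆ Icc a b :=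
  Icc_subset_Icc (𝒯.knot_mem _).1 (𝒯.knot_mem _).2

theorem exists_mem_Icc (hab : a < b) {t : ℝ} (ht : t ∈ Icc a b) :
    ∃ j : Fin 𝒯.n, t ∈ Icc (𝒯.knot j.castSucc) (𝒯.knot j.succ) := by
  rcases eq_or_lt_of_le ht.1 with rfl | h
  · obtain ⟨i, h1, h2⟩ := exists_castSucc_le_lt_succ 𝒯.knot 𝒯.knot_zero.le
      (by rw [𝒯.knot_last]; exact hab)
    exact ⟨i, h1, h2.le⟩
  · obtain ⟨i, h1, h2⟩ := exists_castSucc_lt_le_succ 𝒯.knot (by rwa [𝒯.knot_zero])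
      (by rw [𝒯.knot_last]; exact ht.2)
    exact ⟨i, h1.le, h2⟩

variable {𝒯}

theorem element_subset (h : ChordArcParam γ a b Γ C) (j : Fin 𝒯.n) : 𝒯.element j ⊆ Γ :=
  h.image_eq ▸ image_mono (𝒯.Icc_knot_subset j)

theorem iUnion_element (h : ChordArcParam γ a b Γ C) : ⋃ j, 𝒯.element j = Γ := by
  refine subset_antisymm (iUnion_subset fun j => element_subset h j) fun x hx => ?_
  rw [← h.image_eq] at hx
  obtain ⟨t, ht, rfl⟩ := hx
  obtain ⟨j, hj⟩ := 𝒯.exists_mem_Icc h.lt ht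
  exact mem_iUnion.2 ⟨j, mem_image_of_mem _ hj⟩

theorem isClosed_element (h : ChordArcParam γ a b Γ C) (j : Fin 𝒯.n) :
    IsClosed (𝒯.element j) :=
  h.isClosed_image_Icc (𝒯.knot_mem _).1 (𝒯.knot_mem _).2

theorem isPreconnected_element (h : ChordArcParam γ a b Γ C) (j : Fin 𝒯.n) :
    IsPreconnected (𝒯.element j) :=
  isPreconnected_Icc.image _ (h.continuousOn.mono (𝒯.Icc_knot_subset j))

theorem node_left_mem_element (j : Fin 𝒯.n) : γ (𝒯.knot j.castSucc) ∈ 𝒯.element j :=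
  mem_image_of_mem _ (left_mem_Icc.2 (𝒯.knot_lt_succ j).le)

theorem node_right_mem_element (j : Fin 𝒯.n) : γ (𝒯.knot j.succ) ∈ 𝒯.element j :=
  mem_image_of_mem _ (right_mem_Icc.2 (𝒯.knot_lt_succ j).le)

theorem knot_mem_nodes (i : Fin (𝒯.n + 1)) : γ (𝒯.knot i) ∈ 𝒯.nodes := by
  simp [nodes]

theorem measure_element_ne_zero (h : ChordArcParam γ a b Γ C) (j : Fin 𝒯.n) :
    μH[1] (𝒯.element j) ≠ 0 := by
  have hlt := 𝒯.knot_lt_succ j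
  set s := 𝒯.knot j.castSucc
  have hs : s ∈ Icc a b := 𝒯.knot_mem _
  have hsb := (𝒯.knot_mem j.succ).2
  -- The midpoint rather than the right knot: a single element may be the whole closed curve, whose
  -- end points coincide.
  set t := (s + 𝒯.knot j.succ) / 2 with ht
  have h1 : s < t := by linarith
  have h2 : t < 𝒯.knot j.succ := by linarith
  have hne : γ s ≠ γ t := fun he => by
    rcases h.eq_or_of_apply_eq hs ⟨hs.1.trans h1.le, h2.le.trans hsb⟩ he with
      e | ⟨-, e⟩ | ⟨-, e⟩
    · linarith
    · linarith
    · linarith [hs.1]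
  have := IsPreconnected.edist_le_hausdorffMeasure (isPreconnected_element h j)
    (node_left_mem_element j) (mem_image_of_mem γ ⟨h1.le, h2.le⟩)
  exact fun h0 => hne (edist_eq_zero.1 (le_antisymm (h0 ▸ this) zero_le))

theorem meets_self (i : Fin 𝒯.n) : Meets 𝒯.element i i :=
  ⟨_, node_left_mem_element i, node_left_mem_element i⟩

theorem meets_of_succ_eq {i k : Fin 𝒯.n} (hik : i.val + 1 = k.val) : Meets 𝒯.element i k := by
  have e : i.succ = k.castSucc := Fin.ext (by simpa using hik)
  exact ⟨_, node_right_mem_element i, e ▸ node_left_mem_element k⟩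

theorem meets_of_wrap (hab : γ a = γ b) {i k : Fin 𝒯.n} (hi : i.val = 0)
    (hk : k.val + 1 = 𝒯.n) : Meets 𝒯.element i k := by
  have e : i.castSucc = 0 := Fin.ext (by simpa using hi)
  have e' : k.succ = Fin.last _ := Fin.ext (by simpa using hk)
  refine ⟨γ a, ?_, ?_⟩
  · have := node_left_mem_element i
    rwa [e, 𝒯.knot_zero] at this
  · have := node_right_mem_element k
    rwa [e', 𝒯.knot_last, ← hab] at this

theorem val_eq_zero_of_left_mem {i : Fin 𝒯.n}
    (hi : a ∈ Icc (𝒯.knot i.castSucc) (𝒯.knot i.succ)) : i.val = 0 := by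
  have h1 := hi.1.trans 𝒯.knot_zero.symm.le
  rw [𝒯.strictMono.le_iff_le] at h1
  have h2 := Fin.le_def.1 h1
  simpa using h2

theorem val_succ_eq_of_right_mem {i : Fin 𝒯.n}
    (hi : b ∈ Icc (𝒯.knot i.castSucc) (𝒯.knot i.succ)) : i.val + 1 = 𝒯.n := by
  have h1 := 𝒯.knot_last.le.trans hi.2
  rw [𝒯.strictMono.le_iff_le] at h1
  have := i.isLt
  have h2 : 𝒯.n ≤ i.val + 1 := by simpa [Fin.le_def] using h1
  omega

/-- Elements that meet are neighbours and have a common node. -/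
theorem exists_node_of_meets (h : ChordArcParam γ a b Γ C) {i k : Fin 𝒯.n}
    (hik : Meets 𝒯.element i k) :
    (k.val = i.val ∨ k.val = i.val + 1 ∨ k.val = i.val - 1 ∨ k.val = 0 ∨ k.val = 𝒯.n - 1) ∧
      ∃ z ∈ 𝒯.nodes, z ∈ 𝒯.element i ∧ z ∈ 𝒯.element k := by
  obtain ⟨x, ⟨s, hs, rfl⟩, ⟨t, ht, hts⟩⟩ := hik
  have hsi : γ s ∈ 𝒯.element i := mem_image_of_mem _ hs
  have htk : γ s ∈ 𝒯.element k := hts ▸ mem_image_of_mem _ ht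
  have ordered : ∀ {i k : Fin 𝒯.n} {s : ℝ}, s ∈ Icc (𝒯.knot i.castSucc) (𝒯.knot i.succ) →
      s ∈ Icc (𝒯.knot k.castSucc) (𝒯.knot k.succ) → i.val < k.val →
      k.val = i.val + 1 ∧ s = 𝒯.knot i.succ := by
    intro i k s hs ht hlt
    have h1 := 𝒯.knot_succ_le_castSucc hlt
    have h2 : 𝒯.knot k.castSucc ≤ 𝒯.knot i.succ := ht.1.trans hs.2
    rw [𝒯.strictMono.le_iff_le, Fin.le_def] at h2
    simp only [Fin.val_castSucc, Fin.val_succ] at h2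
    exact ⟨by omega, le_antisymm hs.2 (h1.trans ht.1)⟩
  rcases h.eq_or_of_apply_eq (𝒯.Icc_knot_subset i hs) (𝒯.Icc_knot_subset k ht) hts.symm with
    e | ⟨e, e'⟩ | ⟨e, e'⟩
  · subst e
    rcases lt_trichotomy i.val k.val with hlt | heq | hlt
    · obtain ⟨h1, h2⟩ := ordered hs ht hlt
      exact ⟨Or.inr (Or.inl h1), γ s, h2 ▸ knot_mem_nodes _, hsi, htk⟩
    · obtain rfl := Fin.ext heq
      exact ⟨Or.inl rfl, _, knot_mem_nodes _, node_left_mem_element i, node_left_mem_element i⟩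
    · obtain ⟨h1, h2⟩ := ordered ht hs hlt
      exact ⟨Or.inr (Or.inr (Or.inl (by omega))), γ s, h2 ▸ knot_mem_nodes _, hsi, htk⟩
  · subst e e'
    refine ⟨Or.inr (Or.inr (Or.inr (Or.inr ?_))), γ s, ?_, hsi, htk⟩
    · have := val_succ_eq_of_right_mem ht
      omega
    · have := 𝒯.knot_mem_nodes 0
      rwa [𝒯.knot_zero] at this
  · subst e e'
    refine ⟨Or.inr (Or.inr (Or.inr (Or.inl (val_eq_zero_of_left_mem ht)))), γ s, ?_, hsi, htk⟩
    have := 𝒯.knot_mem_nodes (Fin.last _)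
    rwa [𝒯.knot_last] at this

/-- The candidates are `i`, its two neighbours in the order, and the two extreme elements, which may
touch at the seam. -/
theorem card_nbhd_le (h : ChordArcParam γ a b Γ C) (i : Fin 𝒯.n) :
    (nbhd (Meets 𝒯.element) i).card ≤ 5 := by
  have hsub : (nbhd (Meets 𝒯.element) i).map Fin.valEmbedding ⊆
      {i.val, i.val + 1, i.val - 1, 0, 𝒯.n - 1} := by
    intro l hl
    obtain ⟨k, hk, rfl⟩ := Finset.mem_map.1 hl
    simpa using (exists_node_of_meets h (mem_nbhd.1 hk)).1
  calc _ = ((nbhd (Meets 𝒯.element) i).map Fin.valEmbedding).card := (Finset.card_map _).symm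
    _ ≤ _ := Finset.card_le_card hsub
    _ ≤ 5 := Finset.card_le_five

open Classical in
/-- The indices of the elements that contain `z`. -/
def star (𝒯 : Mesh γ a b) (z : Plane) : Finset (Fin 𝒯.n) :=
  Finset.univ.filter fun i => z ∈ 𝒯.element i

theorem mem_star {z : Plane} {i : Fin 𝒯.n} : i ∈ 𝒯.star z ↔ z ∈ 𝒯.element i := by simp [star]

theorem card_star_le (h : ChordArcParam γ a b Γ C) (z : Plane) : (𝒯.star z).card ≤ 5 := by
  rcases (𝒯.star z).eq_empty_or_nonempty with h0 | ⟨i, hi⟩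
  · simp [h0]
  · refine (Finset.card_le_card fun k hk => mem_nbhd.2 ?_).trans (card_nbhd_le h i)
    exact ⟨z, mem_star.1 hi, mem_star.1 hk⟩

/-- A connected part of the curve that joins an element to a point off its neighbours contains a
neighbour. -/
theorem exists_element_subset (h : ChordArcParam γ a b Γ C) {A : Set Plane}
    (hA : IsPreconnected A) (hAΓ : A ⊆ Γ) {i k : Fin 𝒯.n} (hik : ¬ Meets 𝒯.element i k)
    {x y : Plane} (hx : x ∈ 𝒯.element i) (hy : y ∈ 𝒯.element k) (hxA : x ∈ A) (hyA : y ∈ A) :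
    ∃ l, Meets 𝒯.element i l ∧ 𝒯.element l ⊆ A := by
  -- Otherwise `A` misses a point in every neighbour, and these gaps cut the element off from `y`.
  by_contra! H
  have gap : ∀ l, Meets 𝒯.element i l →
      ∃ σ ∈ Icc (𝒯.knot l.castSucc) (𝒯.knot l.succ), γ σ ∉ A := by
    intro l hl
    obtain ⟨_, ⟨σ, hσ, rfl⟩, hσA⟩ := not_subset.1 (H l hl)
    exact ⟨σ, hσ, hσA⟩
  obtain ⟨s, hs, rfl⟩ := hx
  obtain ⟨t, ht, rfl⟩ := hy
  have hsI := 𝒯.Icc_knot_subset i hs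
  have htI := 𝒯.Icc_knot_subset k ht
  have hle : ∀ {l l' : Fin 𝒯.n} {r r' : ℝ}, r ∈ Icc (𝒯.knot l.castSucc) (𝒯.knot l.succ) →
      r' ∈ Icc (𝒯.knot l'.castSucc) (𝒯.knot l'.succ) → l.val < l'.val → r ≤ r' :=
    fun hr hr' hl => hr.2.trans ((𝒯.knot_succ_le_castSucc hl).trans hr'.1)
  have hki : k.val ≠ i.val := fun e => hik (by
    obtain rfl := Fin.ext e
    exact meets_self k)
  have hki1 : i.val + 1 ≠ k.val := fun e => hik (meets_of_succ_eq e)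
  have hki2 : k.val + 1 ≠ i.val := fun e => hik (meets_of_succ_eq e).symm
  have hkn := k.isLt
  have hin := i.isLt
  by_cases h0 : i.val = 0
  · obtain ⟨σ, hσ, hσA⟩ := gap ⟨i.val + 1, by omega⟩ (meets_of_succ_eq rfl)
    have hσI := 𝒯.Icc_knot_subset _ hσ
    have hsσ : s ≤ σ := hle hs hσ (Nat.lt_succ_self _)
    have hσt : σ ≤ t := hle hσ ht (by simp only; omega)
    -- On a closed curve the first element also has the last one as a neighbour, which supplies the
    -- second gap; on an open curve one gap is enough.
    by_cases hab : γ a = γ b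
    · obtain ⟨τ, hτ, hτA⟩ := gap ⟨𝒯.n - 1, by omega⟩
        (meets_of_wrap hab h0 (by simp only; omega))
      have hτI := 𝒯.Icc_knot_subset _ hτ
      have hkn' : k.val + 1 ≠ 𝒯.n := fun e => hik (meets_of_wrap hab h0 e)
      have htτ : t ≤ τ := hle ht hτ (by simp only; omega)
      exact h.not_mem_of_two_gaps hA hAΓ hσI.1 hτI.2 (hσt.trans htτ) hσA hτA ⟨hσt, htτ⟩
        (Or.inl ⟨hsI.1, hsσ⟩) hyA hxA
    · exact h.not_mem_of_gap hab hA hAΓ hσI hσA ⟨hsI.1, hsσ⟩ ⟨hσt, htI.2⟩ hxA hyA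
  · obtain ⟨τ, hτ, hτA⟩ := gap ⟨i.val - 1, by omega⟩
      (meets_of_succ_eq (by simp only; omega)).symm
    have hτI := 𝒯.Icc_knot_subset _ hτ
    have hτs : τ ≤ s := hle hτ hs (by simp only; omega)
    by_cases h1 : i.val + 1 = 𝒯.n
    · have htτ : t ≤ τ := hle ht hτ (by simp only; omega)
      by_cases hab : γ a = γ b
      · obtain ⟨σ, hσ, hσA⟩ := gap ⟨0, by omega⟩ (meets_of_wrap hab rfl h1).symm
        have hσI := 𝒯.Icc_knot_subset _ hσ
        have hk0 : k.val ≠ 0 := fun e => hik (meets_of_wrap hab e h1).symm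
        have hσt : σ ≤ t := hle hσ ht (by simp only; omega)
        exact h.not_mem_of_two_gaps hA hAΓ hσI.1 hτI.2 (hσt.trans htτ) hσA hτA ⟨hσt, htτ⟩
          (Or.inr ⟨hτs, hsI.2⟩) hyA hxA
      · exact h.not_mem_of_gap hab hA hAΓ hτI hτA ⟨htI.1, htτ⟩ ⟨hτs, hsI.2⟩ hyA hxA
    · obtain ⟨σ, hσ, hσA⟩ := gap ⟨i.val + 1, by omega⟩ (meets_of_succ_eq rfl)
      have hσI := 𝒯.Icc_knot_subset _ hσ
      have hsσ : s ≤ σ := hle hs hσ (Nat.lt_succ_self _)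
      refine h.not_mem_of_two_gaps hA hAΓ hτI.1 hσI.2 (hτs.trans hsσ) hτA hσA ⟨hτs, hsσ⟩ ?_
        hxA hyA
      rcases lt_or_gt_of_ne hki with hlt | hlt
      · exact Or.inl ⟨htI.1, hle ht hτ (by simp only; omega)⟩
      · exact Or.inr ⟨hle hσ ht (by simp only; omega), htI.2⟩

theorem patch_subset (j : Fin 𝒯.n) (m : ℕ) :
    𝒯.patch j m ⊆ ⋃ i ∈ ball (Meets 𝒯.element) j m, 𝒯.element i := by
  induction m with
  | zero => exact fun x hx => mem_iUnion₂.2 ⟨j, mem_ball_zero.2 rfl, hx⟩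
  | succ m ih =>
    rintro x ⟨i, ⟨y, hyi, hy⟩, hx⟩
    obtain ⟨k, hk, hyk⟩ := mem_iUnion₂.1 (ih hy)
    exact mem_iUnion₂.2 ⟨i, mem_ball_succ.2 ⟨k, hk, y, hyk, hyi⟩, hx⟩

theorem measure_element_ne_top (h : ChordArcParam γ a b Γ C) (j : Fin 𝒯.n) :
    μH[1] (𝒯.element j) ≠ ∞ :=
  ((measure_mono (element_subset h j)).trans_lt h.measure_lt_top).ne

theorem len_pos (h : ChordArcParam γ a b Γ C) (j : Fin 𝒯.n) : 0 < 𝒯.len j :=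
  ENNReal.toReal_pos (measure_element_ne_zero h j) (measure_element_ne_top h j)

theorem div_le_shapeConst {i k : Fin 𝒯.n} (hik : Meets 𝒯.element i k) :
    𝒯.len i / 𝒯.len k ≤ 𝒯.shapeConst := by
  -- A real supremum dominates the members only of a bounded set; here there are finitely many
  -- ratios.
  refine le_csSup (Set.Finite.bddAbove ?_) ⟨i, k, hik, rfl⟩
  refine (Set.finite_range fun p : Fin 𝒯.n × Fin 𝒯.n => 𝒯.len p.1 / 𝒯.len p.2).subset ?_
  rintro _ ⟨i, k, -, rfl⟩
  exact ⟨(i, k), rfl⟩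

theorem one_le_shapeConst (h : ChordArcParam γ a b Γ C) : 1 ≤ 𝒯.shapeConst := by
  obtain ⟨j, -⟩ := 𝒯.exists_mem_Icc h.lt (left_mem_Icc.2 h.lt.le)
  have := div_le_shapeConst (meets_self j)
  rwa [div_self (len_pos h j).ne'] at this

theorem measure_element_le (h : ChordArcParam γ a b Γ C) {i k : Fin 𝒯.n}
    (hik : Meets 𝒯.element i k) :
    μH[1] (𝒯.element k) ≤ ENNReal.ofReal 𝒯.shapeConst * μH[1] (𝒯.element i) := by
  have h1 := (div_le_iff₀ (len_pos h i)).1 (div_le_shapeConst hik.symm)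
  have h2 := ENNReal.ofReal_le_ofReal h1
  rw [ENNReal.ofReal_mul (zero_le_one.trans (one_le_shapeConst h)), len, len,
    ENNReal.ofReal_toReal (measure_element_ne_top h _),
    ENNReal.ofReal_toReal (measure_element_ne_top h _)] at h2
  exact h2

theorem edist_le_add (h : ChordArcParam γ a b Γ C) {i k : Fin 𝒯.n}
    (hik : Meets 𝒯.element i k) {x y : Plane} (hx : x ∈ 𝒯.element i) (hy : y ∈ 𝒯.element k) :
    edist x y ≤ μH[1] (𝒯.element i) + μH[1] (𝒯.element k) := by
  obtain ⟨z, hzi, hzk⟩ := hik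
  exact (edist_triangle x z y).trans (add_le_add
    (IsPreconnected.edist_le_hausdorffMeasure (isPreconnected_element h i) hx hzi)
    (IsPreconnected.edist_le_hausdorffMeasure (isPreconnected_element h k) hzk hy))

/-- The sum over pairs of intersecting elements is controlled by the node patches. -/
theorem sum_pairSemiSq_le (h : ChordArcParam γ a b Γ C) (u : Plane → ℝ) :
    ∑ i, ∑ k ∈ nbhd (Meets 𝒯.element) i, pairSemiSq μH[1] u (𝒯.element i) (𝒯.element k) ≤
      25 * ∑ z ∈ 𝒯.nodes, hHalfSemiSq (𝒯.nodePatch z) u := by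
  classical
  have hpair : ∀ z i k, z ∈ 𝒯.element i → z ∈ 𝒯.element k →
      pairSemiSq μH[1] u (𝒯.element i) (𝒯.element k) ≤ hHalfSemiSq (𝒯.nodePatch z) u := by
    intro z i k hi hk
    have hi' : 𝒯.element i ⊆ 𝒯.nodePatch z := fun x hx => ⟨i, hi, hx⟩
    have hk' : 𝒯.element k ⊆ 𝒯.nodePatch z := fun x hx => ⟨k, hk, hx⟩
    exact lintegral_mono' (Measure.restrict_mono hi' le_rfl)
      fun x => lintegral_mono' (Measure.restrict_mono hk' le_rfl) le_rfl
  -- Each pair is charged to a common node, and a node is charged for at most `5 * 5` pairs.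
  calc ∑ i, ∑ k ∈ nbhd (Meets 𝒯.element) i, pairSemiSq μH[1] u (𝒯.element i) (𝒯.element k)
      ≤ ∑ i, ∑ k, ∑ z ∈ 𝒯.nodes,
          if z ∈ 𝒯.element i ∧ z ∈ 𝒯.element k then hHalfSemiSq (𝒯.nodePatch z) u else 0 := by
        refine Finset.sum_le_sum fun i _ => ?_
        refine le_trans (Finset.sum_le_sum fun k hk => ?_)
          (Finset.sum_le_sum_of_subset (Finset.subset_univ (nbhd (Meets 𝒯.element) i)))
        obtain ⟨z, hz, hzi, hzk⟩ := (exists_node_of_meets h (mem_nbhd.1 hk)).2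
        refine le_trans ?_ (Finset.single_le_sum (f := fun z =>
          if z ∈ 𝒯.element i ∧ z ∈ 𝒯.element k then hHalfSemiSq (𝒯.nodePatch z) u else 0)
          (fun _ _ => zero_le) hz)
        simp only [hzi, hzk, and_self, if_true]
        exact hpair z i k hzi hzk
    _ = ∑ z ∈ 𝒯.nodes, ∑ i, ∑ k,
          if z ∈ 𝒯.element i ∧ z ∈ 𝒯.element k then hHalfSemiSq (𝒯.nodePatch z) u else 0 := by
        rw [Finset.sum_comm]
        simp_rw [fun z => Finset.sum_comm (s := Finset.univ) (t := Finset.univ)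
          (f := fun i k => if z ∈ 𝒯.element i ∧ z ∈ 𝒯.element k then
            hHalfSemiSq (𝒯.nodePatch z) u else 0)]
        rw [Finset.sum_comm (s := 𝒯.nodes)]
        refine Finset.sum_congr rfl fun k _ => ?_
        rw [Finset.sum_comm]
    _ = ∑ z ∈ 𝒯.nodes, ((𝒯.star z).card * (𝒯.star z).card) * hHalfSemiSq (𝒯.nodePatch z) u := by
        refine Finset.sum_congr rfl fun z _ => ?_
        rw [← Finset.sum_product', ← Finset.sum_filter, Finset.sum_const, nsmul_eq_mul]
        have : (Finset.univ ×ˢ Finset.univ).filter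
            (fun p : Fin 𝒯.n × Fin 𝒯.n => z ∈ 𝒯.element p.1 ∧ z ∈ 𝒯.element p.2) =
              𝒯.star z ×ˢ 𝒯.star z := by
          ext p; simp [mem_star]
        rw [this, Finset.card_product]
        push_cast
        rfl
    _ ≤ ∑ z ∈ 𝒯.nodes, 25 * hHalfSemiSq (𝒯.nodePatch z) u := by
        refine Finset.sum_le_sum fun z _ => mul_le_mul' ?_ le_rfl
        exact_mod_cast Nat.mul_le_mul (card_star_le h z) (card_star_le h z)
    _ = _ := by rw [Finset.mul_sum]

end Mesh

/-! ### Localization on chord-arc curves -/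

/-- `Γ` has finite length, linear growth, and any two of its points are joined by a part of `Γ`
whose length is bounded by their distance. -/
structure IsChordArc (Γ : Set Plane) (D : ℝ≥0∞) : Prop where
  ne_zero : D ≠ 0
  ne_top : D ≠ ∞
  measure_le : μH[1] Γ ≤ D
  growth : ∀ x ∈ Γ, ∀ ρ : ℝ≥0∞, ρ ≠ 0 → μH[1] (Γ ∩ {y | edist x y ≤ ρ}) ≤ D * ρ
  chord : ∀ x ∈ Γ, ∀ y ∈ Γ, ∃ A ⊆ Γ, IsPreconnected A ∧ x ∈ A ∧ y ∈ A ∧ μH[1] A ≤ D * edist x y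

theorem ChordArcParam.exists_isChordArc {γ : ℝ → Plane} {a b C : ℝ} {Γ : Set Plane}
    (h : ChordArcParam γ a b Γ C) : ∃ D, IsChordArc Γ D := by
  set M := ENNReal.ofReal C * ENNReal.ofReal (4 * C) + 1
  set K := ENNReal.ofReal C * ENNReal.ofReal C
  have hM : M ≤ μH[1] Γ + (M + K) := le_self_add.trans le_add_self
  have hK : K ≤ μH[1] Γ + (M + K) := le_add_self.trans le_add_self
  refine ⟨μH[1] Γ + (M + K), ?_, ?_, le_self_add, fun x hx ρ hρ => ?_, fun x hx y hy => ?_⟩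
  · exact (lt_of_lt_of_le (by simp [M]) hM).ne'
  · have := h.measure_lt_top
    finiteness
  · exact (h.measure_closedBall_le hx hρ).trans (mul_le_mul' hM le_rfl)
  · obtain ⟨A, hA, h1, h2, h3, h4⟩ := h.exists_preconnected hx hy
    exact ⟨A, hA, h1, h2, h3, h4.trans (mul_le_mul' hK le_rfl)⟩

/-- The constant of the localization. -/
def localizationConst (D : ℝ≥0∞) (m : ℕ) (κ q : ℝ) : ℝ≥0∞ :=
  (1 + (D + 16 * D * (ENNReal.ofReal κ * D)) * ((ENNReal.ofReal (2 * q))⁻¹ *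
    ENNReal.ofReal κ ^ (2 * m) * (4 * (5 : ℕ) ^ m * (2 * (5 : ℕ) + 2) ^ m) *
      (4 * ENNReal.ofReal κ))) * 25

theorem localizationConst_ne_top {D : ℝ≥0∞} (hD : D ≠ ∞) (m : ℕ) (κ : ℝ) {q : ℝ} (hq : 0 < q) :
    localizationConst D m κ q ≠ ∞ := by
  have : (ENNReal.ofReal (2 * q))⁻¹ ≠ ∞ := by
    simp [hq]
  unfold localizationConst
  finiteness

/-! ### Assembly of the estimate on `Γ` -/

section

variable {γ : ℝ → Plane} {a b C : ℝ} {Γ : Set Plane} {𝒯 : Mesh γ a b}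

theorem suppOn_subset (h : ChordArcParam γ a b Γ C) (ψ : Plane → ℝ) : suppOn Γ ψ ⊆ Γ := by
  refine closure_minimal (fun x hx => hx.1) ?_
  rw [← h.image_eq]
  exact h.isClosed_image_Icc le_rfl le_rfl

/-- On `Γ` outside its support `ψ` vanishes, so orthogonality on `Γ` is orthogonality on the
support. -/
theorem l2NormSq_suppOn_le (h : ChordArcParam γ a b Γ C) {u ψ : Plane → ℝ} (hu : MemL2 Γ u)
    (hψ : MemL2 Γ ψ) {q : ℝ} (hq : q ≤ 1) (horth : ∫ x in Γ, u x * ψ x ∂μH[1] = 0)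
    (hnear : l2NormSq (suppOn Γ ψ) (fun x => 1 - ψ x) ≤
      ENNReal.ofReal (1 - q) * μH[1] (suppOn Γ ψ)) :
    ENNReal.ofReal (2 * q) * μH[1] (suppOn Γ ψ) * l2NormSq (suppOn Γ ψ) u ≤
      sqOsc u (μH[1].restrict (suppOn Γ ψ)) (μH[1].restrict (suppOn Γ ψ)) := by
  have hsub := suppOn_subset h ψ
  have hmono : (μH[1] : Measure Plane).restrict (suppOn Γ ψ) ≤ μH[1].restrict Γ :=
    Measure.restrict_mono hsub le_rfl
  have : IsFiniteMeasure ((μH[1] : Measure Plane).restrict (suppOn Γ ψ)) :=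
    ⟨by rw [Measure.restrict_apply_univ]; exact (measure_mono hsub).trans_lt h.measure_lt_top⟩
  have horth' : ∫ x in suppOn Γ ψ, u x * ψ x ∂μH[1] = 0 := by
    rw [← horth]
    refine (setIntegral_eq_of_subset_of_forall_sdiff_eq_zero ?_ hsub fun x hx => ?_).symm
    · rw [← h.image_eq]
      exact (h.isClosed_image_Icc le_rfl le_rfl).measurableSet
    · by_contra hne
      exact hx.2 (subset_closure ⟨hx.1, right_ne_zero_of_mul hne⟩)
  have := lintegral_sq_le_sqOsc (hu.mono_measure hmono) (hψ.mono_measure hmono) hq horth'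
    (by rwa [Measure.restrict_apply_univ])
  rwa [Measure.restrict_apply_univ] at this

theorem hHalfNormSq_le_of_measurable (h : ChordArcParam γ a b Γ C) {D : ℝ≥0∞}
    (hD : IsChordArc Γ D) {X : Submodule ℝ (Plane → ℝ)} (hX : ∀ v ∈ X, MemL2 Γ v) {m : ℕ} {q : ℝ}
    (hq0 : 0 < q) (hq1 : q ≤ 1) {ψ : Fin 𝒯.n → Plane → ℝ} (hA1 : AssumptionA1 Γ 𝒯 X m ψ)
    (hA2 : AssumptionA2 Γ 𝒯 q ψ) {u : Plane → ℝ} (hum : Measurable u) (hu : MemL2 Γ u)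
    (horth : ∀ j, ∫ x in Γ, u x * ψ j x ∂μH[1] = 0) :
    hHalfNormSq Γ u ≤ localizationConst D m 𝒯.shapeConst q *
      ∑ z ∈ 𝒯.nodes, hHalfSemiSq (𝒯.nodePatch z) u := by
  set μ : Measure Plane := μH[1].restrict Γ with hμ
  set T := 𝒯.element with hTdef
  set κ := ENNReal.ofReal 𝒯.shapeConst with hκdef
  have : IsFiniteMeasure μ :=
    ⟨by rw [Measure.restrict_apply_univ]; exact h.measure_lt_top⟩
  have hrestr : ∀ {ω : Set Plane}, ω ⊆ Γ → μ.restrict ω = μH[1].restrict ω := fun hω =>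
    Measure.restrict_restrict_of_subset hω
  have hμeq : ∀ {ω : Set Plane}, ω ⊆ Γ → μ ω = μH[1] ω := fun {ω} hω => by
    rw [← Measure.restrict_apply_univ ω, hrestr hω, Measure.restrict_apply_univ]
  have hTΓ : ∀ i, T i ⊆ Γ := Mesh.element_subset h
  have hT : ∀ i, MeasurableSet (T i) := fun i => (Mesh.isClosed_element h i).measurableSet
  have hμT : ∀ i, μ (T i) = μH[1] (T i) := fun i => hμeq (hTΓ i)
  have hΓ : MeasurableSet Γ := by
    rw [← Mesh.iUnion_element (𝒯 := 𝒯) h]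
    exact MeasurableSet.iUnion hT
  have hcover : ∀ᵐ x ∂μ, ∃ i, x ∈ T i := by
    filter_upwards [ae_restrict_mem hΓ] with x hx
    rw [← Mesh.iUnion_element (𝒯 := 𝒯) h] at hx
    exact mem_iUnion.1 hx
  have hpos : ∀ i, μ (T i) ≠ 0 := fun i => hμT i ▸ Mesh.measure_element_ne_zero h i
  have hκ1 : 1 ≤ κ := by
    rw [hκdef, ENNReal.one_le_ofReal]
    exact Mesh.one_le_shapeConst h
  have hκ : ∀ i k, Meets T i k → μ (T k) ≤ κ * μ (T i) := fun i k hik => by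
    rw [hμT, hμT]
    exact Mesh.measure_element_le h hik
  have hdiam : ∀ i k, Meets T i k → ∀ x ∈ T i, ∀ y ∈ T k, edist x y ≤ μ (T i) + μ (T k) :=
    fun i k hik x hx y hy => by
      rw [hμT, hμT]
      exact Mesh.edist_le_add h hik hx hy
  have hM : ∀ i, ∀ x ∈ T i, ∀ ρ : ℝ≥0∞, ρ ≠ 0 → μ {y | edist x y ≤ ρ} ≤ D * ρ :=
    fun i x hx ρ hρ => by
      rw [hμ, Measure.restrict_apply' hΓ, inter_comm]
      exact hD.growth x (hTΓ i hx) ρ hρ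
  -- The short arc from `x` to `y` contains a neighbour `T l` of `T i`, and `h_i ≤ κ h_l`.
  have hfar : ∀ i k, ¬ Meets T i k → ∀ x ∈ T i, ∀ y ∈ T k, μ (T i) ≤ κ * D * edist x y := by
    intro i k hik x hx y hy
    obtain ⟨A, hAΓ, hA, hxA, hyA, hle⟩ := hD.chord x (hTΓ i hx) y (hTΓ k hy)
    obtain ⟨l, hl, hlA⟩ := Mesh.exists_element_subset h hA hAΓ hik hx hy hxA hyA
    calc μ (T i) ≤ κ * μ (T l) := hκ l i hl.symm
      _ ≤ κ * (D * edist x y) := by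
          gcongr
          rw [hμT]
          exact (measure_mono hlA).trans hle
      _ = κ * D * edist x y := by rw [mul_assoc]
  have hω : ∀ j, suppOn Γ (ψ j) ⊆ Γ := fun j => suppOn_subset h (ψ j)
  have hpoinc : ∀ j, ENNReal.ofReal (2 * q) * μ (suppOn Γ (ψ j)) *
      ∫⁻ x in suppOn Γ (ψ j), ENNReal.ofReal (u x ^ 2) ∂μ ≤
        sqOsc u (μ.restrict (suppOn Γ (ψ j))) (μ.restrict (suppOn Γ (ψ j))) := fun j => by
    rw [hrestr (hω j), hμeq (hω j)]
    exact l2NormSq_suppOn_le h hu (hX _ (hA1 j).1) hq1 (horth j) (hA2 j)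
  set N := ∑ i, ∑ k ∈ nbhd (Meets T) i, pairSemiSq μ u (T i) (T k) with hN
  have hscaled : scaledL2 μ u T ≤ (ENNReal.ofReal (2 * q))⁻¹ * κ ^ (2 * m) *
      (4 * (5 : ℕ) ^ m * (2 * (5 : ℕ) + 2) ^ m) * (4 * κ) * N :=
    scaledL2_le hum hT hpos hκ1 hκ hdiam (Mesh.card_nbhd_le h) (by simp [hq0])
      ENNReal.ofReal_ne_top (fun j => (hA1 j).2.2.1)
      (fun j => (hA1 j).2.2.2.trans (Mesh.patch_subset j m)) hpoinc
  have hnear : N ≤ 25 * ∑ z ∈ 𝒯.nodes, hHalfSemiSq (𝒯.nodePatch z) u := by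
    refine le_of_eq_of_le ?_ (Mesh.sum_pairSemiSq_le h u)
    refine Finset.sum_congr rfl fun i _ => Finset.sum_congr rfl fun k _ => ?_
    unfold pairSemiSq
    rw [hrestr (hTΓ i), hrestr (hTΓ k)]
  have hl2 : l2NormSq Γ u ≤ D * scaledL2 μ u T := by
    refine (lintegral_sq_le_scaledL2 hcover hpos).trans (mul_le_mul' ?_ le_rfl)
    rw [Measure.restrict_apply_univ]
    exact hD.measure_le
  have hsemi : hHalfSemiSq Γ u ≤ N + 16 * D * (κ * D) * scaledL2 μ u T :=
    seminorm_le_near_add_scaledL2 hum hT hcover hpos hM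
      (mul_ne_zero (zero_lt_one.trans_le hκ1).ne' hD.ne_zero)
      (ENNReal.mul_ne_top ENNReal.ofReal_ne_top hD.ne_top) hfar
  set c := (ENNReal.ofReal (2 * q))⁻¹ * κ ^ (2 * m) *
      (4 * (5 : ℕ) ^ m * (2 * (5 : ℕ) + 2) ^ m) * (4 * κ)
  calc hHalfNormSq Γ u ≤ D * scaledL2 μ u T + (N + 16 * D * (κ * D) * scaledL2 μ u T) :=
        add_le_add hl2 hsemi
    _ = N + (D + 16 * D * (κ * D)) * scaledL2 μ u T := by ring
    _ ≤ N + (D + 16 * D * (κ * D)) * (c * N) := by gcongr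
    _ = (1 + (D + 16 * D * (κ * D)) * c) * N := by ring
    _ ≤ (1 + (D + 16 * D * (κ * D)) * c) *
          (25 * ∑ z ∈ 𝒯.nodes, hHalfSemiSq (𝒯.nodePatch z) u) := by gcongr
    _ = _ := by rw [← mul_assoc]; rfl

theorem hHalfSemiSq_congr {ω : Set Plane} (hω : ω ⊆ Γ) {u v : Plane → ℝ}
    (huv : u =ᵐ[μH[1].restrict Γ] v) : hHalfSemiSq ω u = hHalfSemiSq ω v := by
  have h := ae_restrict_of_ae_restrict_of_subset hω huv
  refine lintegral_congr_ae ?_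
  filter_upwards [h] with x hx
  refine lintegral_congr_ae ?_
  filter_upwards [h] with y hy
  rw [hx, hy]

/-- Fubini arguments need a measurable `u`; a representative equal almost everywhere on `Γ` changes
none of the integrals. -/
theorem hHalfNormSq_le (h : ChordArcParam γ a b Γ C) {D : ℝ≥0∞}
    (hD : IsChordArc Γ D) {X : Submodule ℝ (Plane → ℝ)} (hX : ∀ v ∈ X, MemL2 Γ v) {m : ℕ} {q : ℝ}
    (hq0 : 0 < q) (hq1 : q ≤ 1) {ψ : Fin 𝒯.n → Plane → ℝ} (hA1 : AssumptionA1 Γ 𝒯 X m ψ)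
    (hA2 : AssumptionA2 Γ 𝒯 q ψ) {u : Plane → ℝ} (hu : MemL2 Γ u)
    (horth : ∀ j, ∫ x in Γ, u x * ψ j x ∂μH[1] = 0) :
    hHalfNormSq Γ u ≤ localizationConst D m 𝒯.shapeConst q *
      ∑ z ∈ 𝒯.nodes, hHalfSemiSq (𝒯.nodePatch z) u := by
  obtain ⟨v, hv, huv⟩ := hu.1
  have hnorm : hHalfNormSq Γ u = hHalfNormSq Γ v := by
    unfold hHalfNormSq
    rw [hHalfSemiSq_congr subset_rfl huv]
    congr 1
    exact lintegral_congr_ae (huv.mono fun x hx => by simp only [hx])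
  have hpatch : ∀ z, 𝒯.nodePatch z ⊆ Γ := by
    rintro z x ⟨j, -, hx⟩
    exact Mesh.element_subset h j hx
  rw [hnorm, Finset.sum_congr rfl fun z _ => hHalfSemiSq_congr (hpatch z) huv]
  refine hHalfNormSq_le_of_measurable h hD hX hq0 hq1 hA1 hA2 hv.measurable (hu.ae_eq huv)
    fun j => ?_
  rw [← horth j]
  exact integral_congr_ae (huv.mono fun x hx => by simp only [hx])

end

end FaermannBEM

end

theorem proposition3p6 (Γ : Set Plane) :
    ∃ C₃ : ℕ → ℝ → ℝ → ℝ, (∀ m κ q, 0 < C₃ m κ q) ∧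
      ∀ (γ : ℝ → Plane) (a b : ℝ) (𝒯 : Mesh γ a b),
        (IsOpenParam γ a b Γ ∨
          (IsClosedParam γ a b Γ ∧ ∀ j, 𝒯.len j ≤ (μH[1] Γ).toReal / 4)) →
      ∀ (X : Submodule ℝ (Plane → ℝ)), (∀ v ∈ X, MemL2 Γ v) →
      ∀ (m : ℕ) (q : ℝ), 0 < q → q ≤ 1 →
      ∀ ψ : Fin 𝒯.n → Plane → ℝ, AssumptionA1 Γ 𝒯 X m ψ → AssumptionA2 Γ 𝒯 q ψ →
      ∀ u : Plane → ℝ, MemHHalf Γ u →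
        (∀ j, ∫ x in Γ, u x * ψ j x ∂μH[1] = 0) →
        hHalfNormSq Γ u ≤
          ENNReal.ofReal (C₃ m 𝒯.shapeConst q) *
            ∑ z ∈ 𝒯.nodes, hHalfSemiSq (𝒯.nodePatch z) u := by
  -- The constant has to precede the parametrization. If `Γ` has no chord-arc constant, it has no
  -- admissible parametrization either, and any `C₃` will do.
  by_cases hΓ : ∃ D, IsChordArc Γ D
  · obtain ⟨D, hD⟩ := hΓ
    -- The maximum with `1` ensures positivity for all arguments. For `q > 0` the constant is
    -- finite, so `toReal` loses nothing.
    refine ⟨fun m κ q => max 1 (localizationConst D m κ q).toReal,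
      fun m κ q => lt_max_of_lt_left one_pos, ?_⟩
    intro γ a b 𝒯 hγ X hX m q hq0 hq1 ψ hA1 hA2 u hu horth
    obtain ⟨C, hC⟩ : ∃ C, ChordArcParam γ a b Γ C := by
      rcases hγ with h | ⟨h, -⟩
      · exact h.exists_chordArcParam
      · exact h.exists_chordArcParam
    refine (hHalfNormSq_le hC hD hX hq0 hq1 hA1 hA2 hu.1 horth).trans (mul_le_mul' ?_ le_rfl)
    rw [← ENNReal.ofReal_toReal (localizationConst_ne_top hD.ne_top m 𝒯.shapeConst hq0)]
    exact ENNReal.ofReal_le_ofReal (le_max_right _ _)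
  · refine ⟨fun _ _ _ => 1, fun _ _ _ => one_pos, fun γ a b 𝒯 hγ => absurd ?_ hΓ⟩
    rcases hγ with h | ⟨h, -⟩
    · obtain ⟨C, hC⟩ := h.exists_chordArcParam
      exact hC.exists_isChordArc
    · obtain ⟨C, hC⟩ := h.exists_chordArcParam
      exact hC.exists_isChordArc
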